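/- Let $\mathfrak h_S$ and $\mathfrak f_B$ be complex Hilbert spaces (inner products linear in the second argument), let $\Gamma(\mathfrak f_B)=\bigoplus_{n\ge 0}\mathfrak f_B^{\otimes_{\mathrm{sym}} n}$ be the Bose Fock space with vacuum $|\mathrm{vac}\rangle$, creation and annihilation operators $\hat a(g)^*,\hat a(g)$ and exponential vectors $|e^f\rangle=\bigoplus_n \frac{1}{\sqrt{n!}}f^{\otimes n}$. Let $\hat H=\hat H^*$ and $\hat L$ be bounded operators on $\mathfrak h_S$, let $\hat h_B$ be a (possibly unbounded) self-adjoint operator on $\mathfrak f_B$, let $g\in\mathfrak f_B$, and put $$\hat H_0=\hat I\otimes d\Gamma(\hat h_B),\qquad \hat H_{\mathrm{Tot}}=\hat H\otimes \hat I+\hat H_0+i\hat L\otimes\hat a(g)^*-i\hat L^*\otimes\hat a(g),\qquad \hat U_t=e^{it\hat H_0}e^{-it\hat H_{\mathrm{Tot}}},$$ where $\hat H_0$ and $\hat H_{\mathrm{Tot}}$ are defined on the linear span of the vectors $\varphi\otimes\hat a(x_1)^*\cdots\hat a(x_n)^*|\mathrm{vac}\rangle$ with $\varphi\in\mathfrak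 h_S$ and $x_i\in\mathrm{dom}(\hat h_B)$, and the exponentials are the unitary groups they generate. Let $\mathbb T\subseteq\mathbb R$ be an interval and let $t\ge 0$ be such that $[0,t]\subseteq\mathbb T$. For $f\in\mathfrak f_B$ let $\zeta(f):\mathbb T\to\mathbb C$, $\zeta_s(f)=\langle f\,|\,e^{is\hat h_B}g\rangle$, be its complex trajectory, and let $\mathscr C=\{\zeta(f): f\in\mathfrak f_B\}$. For $\phi\in\mathfrak h_S$ let $\tilde\Psi_t(f)\in\mathfrak h_S$ be the vector with $\langle\psi|\tilde\Psi_t(f)\rangle=\langle\psi\otimes e^f|\hat U_t|\phi\otimes\mathrm{vac}\rangle$ for all $\psi\in\mathfrak h_S$, and for $\zeta\in\mathscr C$ let $\Psi_t(\zeta)=\tilde\Psi_t(f_\zeta)$, where $f_\zeta\in\mathfrak f_B$ is any chosen vector with $\zeta(f_\zeta)=\zeta$. Then: 1. $\Psi_t(\zeta(f))=\tilde\Psi_t(f)$ for every $f\in\mathfrak f_B$, that is, $\Psi_t$ does not depend on the choice of the vectors $f_\zeta$. 2. If $\zeta,\zeta'\in\mathscr C$ satisfy $\zeta_s=\zeta'_s$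 for all $s\in[0,t]$, then $\Psi_t(\zeta)=\Psi_t(\zeta')$. 3. $\delta\Psi_t/\delta\zeta_\tau=0$ for $\tau\notin[0,t]$, in the following sense. At every $\zeta\in\mathscr C$ the function $\Psi_t$ has a functional derivative that vanishes outside $[0,t]$: there is a locally integrable $D:\mathbb T\to\mathfrak h_S$ with $D_\tau=0$ for all $\tau\in\mathbb T\setminus[0,t]$ such that, for every $\eta\in\mathscr C$, the function $\tau\mapsto\eta_\tau D_\tau$ is integrable on $\mathbb T$ and the complex derivative $\frac{d}{d\varepsilon}\Psi_t(\zeta+\varepsilon\eta)\big|_{\varepsilon=0}$ exists and equals $\int_{\mathbb T}\eta_\tau D_\tau\,d\tau$. -/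

import Mathlib

open MeasureTheory Topology
open scoped TensorProduct

noncomputable section

namespace BathModel

/-! ### Hilbert tensor powers of the one-particle space -/

/-- The algebraic `n`-fold tensor power of `F`. -/
def AlgTensorPow (F : Type*) [NormedAddCommGroup F] [InnerProductSpace ℂ F] (n : ℕ) : Type _ :=
  PiTensorProduct ℂ (fun _ : Fin n => F)

section TensorPower

variable {F : Type*} [NormedAddCommGroup F] [InnerProductSpace ℂ F]

instance (n : ℕ) : AddCommGroup (AlgTensorPow F n) :=
  inferInstanceAs (AddCommGroup (PiTensorProduct ℂ (fun _ : Fin n => F)))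

instance (n : ℕ) : Module ℂ (AlgTensorPow F n) :=
  inferInstanceAs (Module ℂ (PiTensorProduct ℂ (fun _ : Fin n => F)))

/-- The simple tensor `x₁ ⊗ ⋯ ⊗ xₙ`. -/
def simpleTensor {n : ℕ} (x : Fin n → F) : AlgTensorPow F n := PiTensorProduct.tprod ℂ x

/-- `F^{⊗0} = ℂ`. -/
def tensorZeroEquiv : AlgTensorPow F 0 ≃ₗ[ℂ] ℂ :=
  PiTensorProduct.isEmptyEquiv (R := ℂ) (s := fun _ : Fin 0 => F) (Fin 0)

/-- `F^{⊗(n+1)} = F ⊗ F^{⊗n}`, for Mathlib's tensor powers. -/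
def piSuccEquiv (n : ℕ) : PiTensorProduct ℂ (fun _ : Fin (n + 1) => F) ≃ₗ[ℂ]
    F ⊗[ℂ] PiTensorProduct ℂ (fun _ : Fin n => F) :=
  (PiTensorProduct.reindex ℂ (fun _ : Fin (n + 1) => F)
      ((finSumFinEquiv (m := 1) (n := n)).trans (finCongr (Nat.add_comm 1 n))).symm) ≪≫ₗ
    (PiTensorProduct.tmulEquiv (ι := Fin 1) (ι₂ := Fin n) ℂ F).symm ≪≫ₗ
    TensorProduct.congr
      (PiTensorProduct.subsingletonEquiv (R := ℂ) (s := fun _ : Fin 1 => F) (0 : Fin 1))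
      (LinearEquiv.refl ℂ _)

theorem piSuccEquiv_tprod {n : ℕ} (x : Fin (n + 1) → F) :
    piSuccEquiv n (PiTensorProduct.tprod ℂ x) =
      x 0 ⊗ₜ[ℂ] PiTensorProduct.tprod ℂ (fun i => x i.succ) := by
  have h0 : ((finSumFinEquiv (m := 1) (n := n)).trans (finCongr (Nat.add_comm 1 n)))
      (Sum.inl 0) = 0 := by
    ext; simp
  have h1 : ∀ i : Fin n, ((finSumFinEquiv (m := 1) (n := n)).trans
      (finCongr (Nat.add_comm 1 n))) (Sum.inr i) = i.succ := by
    intro i; ext; simp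
  unfold piSuccEquiv
  rw [LinearEquiv.trans_apply, LinearEquiv.trans_apply, PiTensorProduct.reindex_tprod,
    PiTensorProduct.tmulEquiv_symm_apply, TensorProduct.congr_tmul,
    PiTensorProduct.subsingletonEquiv_apply_tprod]
  simp only [Equiv.symm_symm, h0, h1, LinearEquiv.refl_apply]

/-- `F^{⊗(n+1)} = F ⊗ F^{⊗n}`. -/
def tensorSuccEquiv (n : ℕ) : AlgTensorPow F (n + 1) ≃ₗ[ℂ] F ⊗[ℂ] AlgTensorPow F n :=
  piSuccEquiv n

theorem tensorZeroEquiv_simpleTensor (x : Fin 0 → F) :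
    tensorZeroEquiv (simpleTensor x) = 1 :=
  PiTensorProduct.isEmptyEquiv_apply_tprod (R := ℂ) (s := fun _ : Fin 0 => F) (Fin 0) x

theorem tensorSuccEquiv_simpleTensor {n : ℕ} (x : Fin (n + 1) → F) :
    tensorSuccEquiv n (simpleTensor x) = x 0 ⊗ₜ[ℂ] simpleTensor (fun i => x i.succ) :=
  piSuccEquiv_tprod x

/-- The inner product of `G`, pulled back along a linear isomorphism `E ≃ G`. -/
@[reducible] def pullCore {E G : Type*} [AddCommGroup E] [Module ℂ E] [NormedAddCommGroup G]
    [InnerProductSpace ℂ G] (e : E ≃ₗ[ℂ] G) : InnerProductSpace.Core ℂ E where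
  inner x y := inner ℂ (e x) (e y)
  conj_inner_symm x y := inner_conj_symm _ _
  re_inner_nonneg x := inner_self_nonneg
  add_left x y z := by simp only [map_add, inner_add_left]
  smul_left x y r := by simp only [map_smul, inner_smul_left]
  definite x h := by simpa using h

/-- The inner product of the algebraic tensor power, by recursion from the one of `ℂ` and the
inner product of a tensor product of two spaces; see `inner_simpleTensor`. -/
@[reducible] def tensorCore : (n : ℕ) → InnerProductSpace.Core ℂ (AlgTensorPow F n)
  | 0 => pullCore tensorZeroEquiv
  | n + 1 =>
    letI : NormedAddCommGroup (AlgTensorPow F n) := (tensorCore n).toNormedAddCommGroup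
    letI : InnerProductSpace ℂ (AlgTensorPow F n) := .ofCore (tensorCore n).toCore
    pullCore (tensorSuccEquiv n)

instance (n : ℕ) : NormedAddCommGroup (AlgTensorPow F n) := (tensorCore n).toNormedAddCommGroup

instance (n : ℕ) : InnerProductSpace ℂ (AlgTensorPow F n) := .ofCore (tensorCore n).toCore

theorem inner_simpleTensor {n : ℕ} (x y : Fin n → F) :
    inner ℂ (simpleTensor x) (simpleTensor y) = ∏ i, inner ℂ (x i) (y i) := by
  induction n with
  | zero =>
    change inner ℂ (tensorZeroEquiv (simpleTensor x)) (tensorZeroEquiv (simpleTensor y)) = _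
    simp [tensorZeroEquiv_simpleTensor]
  | succ n ih =>
    change inner ℂ (tensorSuccEquiv n (simpleTensor x)) (tensorSuccEquiv n (simpleTensor y)) = _
    rw [tensorSuccEquiv_simpleTensor, tensorSuccEquiv_simpleTensor, TensorProduct.inner_tmul, ih,
      Fin.prod_univ_succ]

end TensorPower

/-! ### The Bose Fock space -/

section Fock

variable (F : Type*) [NormedAddCommGroup F] [InnerProductSpace ℂ F]

/-- The `n`-fold Hilbert space tensor power of `F`. -/
abbrev TensorPow (n : ℕ) : Type _ := UniformSpace.Completion (AlgTensorPow F n)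

variable {F}

/-- `(n!)^{-1/2} ∑_σ x_{σ 1} ⊗ ⋯ ⊗ x_{σ n}`, which is `a(x₁)* ⋯ a(xₙ)* vac`. -/
def symTensor {n : ℕ} (x : Fin n → F) : TensorPow F n :=
  (((√(n.factorial : ℝ))⁻¹ : ℝ) : ℂ) • ∑ σ : Equiv.Perm (Fin n),
    ((simpleTensor (fun i => x (σ i)) : AlgTensorPow F n) : TensorPow F n)

variable (F)

/-- The symmetric `n`-fold Hilbert space tensor power of `F`: the closed linear span of the
symmetrized simple tensors. -/
def symPow (n : ℕ) : Submodule ℂ (TensorPow F n) :=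
  (Submodule.span ℂ (Set.range (symTensor (F := F) (n := n)))).topologicalClosure

instance (n : ℕ) : CompleteSpace (symPow F n) :=
  inferInstanceAs (CompleteSpace (Submodule.topologicalClosure _))

/-- The Bose Fock space over `F`: the Hilbert space direct sum of the symmetric tensor powers. -/
abbrev Fock : Type _ := lp (fun n : ℕ => symPow F n) 2

variable {F}

/-- The vector `a(x₁)* ⋯ a(xₙ)* vac` of the `n`-particle sector of the Fock space. -/
def productVec {n : ℕ} (x : Fin n → F) : Fock F :=
  lp.single 2 n (⟨symTensor x, Submodule.le_topologicalClosure _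
    (Submodule.subset_span ⟨x, rfl⟩)⟩ : symPow F n)

/-- The Fock vacuum. -/
def vac : Fock F := productVec (Fin.elim0 : Fin 0 → F)

/-- The exponential vector `e^f = ∑ₙ (n!)⁻¹ (a(f)*)ⁿ vac = ⨁ₙ (n!)^{-1/2} f ⊗ ⋯ ⊗ f`. -/
def expVec (f : F) : Fock F := ∑' n : ℕ, ((n.factorial : ℂ))⁻¹ • productVec (fun _ : Fin n => f)

theorem inner_symTensor {n : ℕ} (x y : Fin n → F) :
    inner ℂ (symTensor x) (symTensor y) =
      ∑ σ : Equiv.Perm (Fin n), ∏ i, inner ℂ (x i) (y (σ i)) := by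
  have key : ∀ τ : Equiv.Perm (Fin n),
      ∑ σ : Equiv.Perm (Fin n), ∏ i, inner ℂ (x (τ i)) (y (σ i)) =
        ∑ σ : Equiv.Perm (Fin n), ∏ i, inner ℂ (x i) (y (σ i)) := by
    intro τ
    refine Fintype.sum_equiv (Equiv.mulRight τ⁻¹) _ _ fun σ => ?_
    refine Fintype.prod_equiv τ _ _ fun i => ?_
    simp
  have hs : ((n.factorial : ℝ)) ≠ 0 := by positivity
  have hc : (((√(n.factorial : ℝ))⁻¹ : ℝ) : ℂ) * ((((√(n.factorial : ℝ))⁻¹ : ℝ) : ℂ) * (n.factorial : ℂ)) = 1 := by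
    have : (√(n.factorial : ℝ))⁻¹ * ((√(n.factorial : ℝ))⁻¹ * (n.factorial : ℝ)) = 1 := by
      rw [← mul_assoc, ← mul_inv, Real.mul_self_sqrt (by positivity), inv_mul_cancel₀ hs]
    exact_mod_cast this
  unfold symTensor
  simp only [inner_smul_left, inner_smul_right, sum_inner, inner_sum,
    UniformSpace.Completion.inner_coe, inner_simpleTensor, Complex.conj_ofReal]
  rw [← Finset.mul_sum, Finset.sum_comm, Finset.sum_congr rfl fun τ _ => key τ]
  simp only [Finset.sum_const, Finset.card_univ, Fintype.card_perm, Fintype.card_fin,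
    nsmul_eq_mul]
  linear_combination (∑ σ : Equiv.Perm (Fin n), ∏ i, inner ℂ (x i) (y (σ i))) * hc

theorem inner_productVec {n : ℕ} (x y : Fin n → F) :
    inner ℂ (productVec x) (productVec y) =
      ∑ σ : Equiv.Perm (Fin n), ∏ i, inner ℂ (x i) (y (σ i)) := by
  unfold productVec
  rw [lp.inner_single_left, lp.coeFn_single, Pi.single_eq_same, Submodule.coe_inner,
    inner_symTensor]

theorem inner_productVec_of_ne {n m : ℕ} (h : n ≠ m) (x : Fin n → F) (y : Fin m → F) :
    inner ℂ (productVec x) (productVec y) = 0 := by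
  unfold productVec
  rw [lp.inner_single_left, lp.coeFn_single, Pi.single_eq_of_ne h, inner_zero_right]

theorem norm_productVec_const (n : ℕ) (f : F) :
    ‖productVec (fun _ : Fin n => f)‖ = √(n.factorial : ℝ) * ‖f‖ ^ n := by
  have h : ‖productVec (fun _ : Fin n => f)‖ ^ 2 = (√(n.factorial : ℝ) * ‖f‖ ^ n) ^ 2 := by
    have h1 := inner_self_eq_norm_sq_to_K (𝕜 := ℂ) (productVec (fun _ : Fin n => f))
    rw [inner_productVec] at h1
    simp only [inner_self_eq_norm_sq_to_K, Finset.prod_const, Finset.sum_const, Finset.card_univ,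
      Fintype.card_perm, Fintype.card_fin, nsmul_eq_mul] at h1
    rw [mul_pow, Real.sq_sqrt (by positivity), ← pow_mul, mul_comm n 2, pow_mul]
    apply Complex.ofReal_injective
    push_cast
    exact h1.symm
  exact (pow_left_inj₀ (norm_nonneg _) (by positivity) two_ne_zero).1 h

theorem summable_expVec (f : F) :
    Summable fun n : ℕ => ((n.factorial : ℂ))⁻¹ • productVec (fun _ : Fin n => f) := by
  have h1 : Summable fun n : ℕ => (2 * ‖f‖ ^ 2) ^ n / (n.factorial : ℝ) :=
    Real.summable_pow_div_factorial _
  have h2 : Summable fun n : ℕ => (1 / 2 : ℝ) ^ n := summable_geometric_two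
  refine Summable.of_norm_bounded (h1.add h2) fun n => ?_
  have hn : (0 : ℝ) < n.factorial := by positivity
  rw [norm_smul, norm_productVec_const, norm_inv, Complex.norm_natCast]
  set a := (n.factorial : ℝ)⁻¹ * (√(n.factorial : ℝ) * ‖f‖ ^ n) with ha
  have hsq : a ^ 2 = ((2 * ‖f‖ ^ 2) ^ n / (n.factorial : ℝ)) * (1 / 2 : ℝ) ^ n := by
    rw [ha, mul_pow, mul_pow, Real.sq_sqrt hn.le, div_mul_eq_mul_div, ← mul_pow]
    field_simp
    ring
  nlinarith [sq_nonneg ((2 * ‖f‖ ^ 2) ^ n / (n.factorial : ℝ) - (1 / 2 : ℝ) ^ n),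
    show 0 ≤ (2 * ‖f‖ ^ 2) ^ n / (n.factorial : ℝ) by positivity,
    show 0 ≤ (1 / 2 : ℝ) ^ n by positivity, show 0 ≤ a by positivity]

theorem inner_expVec_productVec (f : F) {n : ℕ} (x : Fin n → F) :
    inner ℂ (expVec f) (productVec x) = ∏ i, inner ℂ f (x i) := by
  have h : inner ℂ (productVec x) (expVec f) = ∏ i, inner ℂ (x i) f := by
    have h1 := (innerSL ℂ (productVec x)).map_tsum (summable_expVec f)
    simp only [innerSL_apply_apply] at h1
    rw [expVec, h1, tsum_eq_single n]
    · rw [inner_smul_right, inner_productVec]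
      simp only [Finset.sum_const, Finset.card_univ, Fintype.card_perm, Fintype.card_fin,
        nsmul_eq_mul]
      rw [← mul_assoc, inv_mul_cancel₀ (by exact_mod_cast n.factorial_ne_zero), one_mul]
    · intro m hm
      rw [inner_smul_right, inner_productVec_of_ne hm.symm, mul_zero]
  rw [← inner_conj_symm, h, map_prod]
  exact Finset.prod_congr rfl fun i _ => inner_conj_symm _ _

theorem inner_expVec (f g : F) :
    inner ℂ (expVec f) (expVec g) = Complex.exp (inner ℂ f g) := by
  have h1 := (innerSL ℂ (expVec f)).map_tsum (summable_expVec g)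
  simp only [innerSL_apply_apply] at h1
  rw [expVec.eq_def g, h1, Complex.exp_eq_exp_ℂ, NormedSpace.exp_eq_tsum ℂ]
  refine tsum_congr fun n => ?_
  rw [inner_smul_right, inner_expVec_productVec]
  simp

end Fock

/-! ### Unitary groups generated by (essentially) self-adjoint operators -/

section UnitaryGroup

variable {E : Type*} [NormedAddCommGroup E] [InnerProductSpace ℂ E]

/-- `V` is a strongly continuous one-parameter unitary group on `E`. Surjectivity of `V t` follows
from the group law. -/
structure IsUnitaryGroup (V : ℝ → E →L[ℂ] E) : Prop where
  map_zero : V 0 = 1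
  map_add : ∀ s t, V (s + t) = V s ∘L V t
  norm_map : ∀ t x, ‖V t x‖ = ‖x‖
  continuous : ∀ x, Continuous fun t => V t x

/-- `V t = e^{-itA}`, where the operator `A` is given by its graph: `V` is a strongly continuous
one-parameter unitary group and `d/dt (V t x) = -i A x` at `t = 0` for all `x` in the domain
of `A`. If `A` is (essentially) self-adjoint, there is exactly one such `V`. -/
structure IsGroupOf (A : Submodule ℂ (E × E)) (V : ℝ → E →L[ℂ] E) : Prop where
  isUnitaryGroup : IsUnitaryGroup V
  hasDerivAt : ∀ p ∈ A, HasDerivAt (fun t => V t p.1) (-Complex.I • p.2) 0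

open Classical in
/-- The unitary group `t ↦ e^{-itA}` of an (essentially) self-adjoint operator `A`, given by its
graph. (The value for an operator that generates no unitary group is irrelevant.) -/
def unitaryGroup (A : Submodule ℂ (E × E)) : ℝ → E →L[ℂ] E :=
  if h : ∃ V, IsGroupOf A V then h.choose else fun _ => 1

end UnitaryGroup

/-! ### System and bath -/

section Model

variable {S F : Type*} [NormedAddCommGroup S] [InnerProductSpace ℂ S]
  [NormedAddCommGroup F] [InnerProductSpace ℂ F]

/-- `a(g)* ψ` for `ψ = a(x₁)* ⋯ a(xₙ)* vac`. -/
def creation (g : F) {n : ℕ} (x : Fin n → F) : Fock F :=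
  productVec (Fin.cons g x : Fin (n + 1) → F)

/-- `a(g) ψ = ∑ᵢ ⟨g, xᵢ⟩ a(x₁)* ⋯ (omit i) ⋯ a(xₙ)* vac` for `ψ = a(x₁)* ⋯ a(xₙ)* vac`. -/
def annihilation (g : F) : {n : ℕ} → (Fin n → F) → Fock F
  | 0, _ => 0
  | _ + 1, x => ∑ i, inner ℂ g (x i) • productVec (fun j => x (i.succAbove j))

/-- `dΓ(h) ψ = ∑ᵢ a(x₁)* ⋯ a(h xᵢ)* ⋯ a(xₙ)* vac` for `ψ = a(x₁)* ⋯ a(xₙ)* vac`, where the `xᵢ`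
are in the domain of `h`. -/
def secondQuant (h : F →ₗ.[ℂ] F) {n : ℕ} (x : Fin n → h.domain) : Fock F :=
  ∑ i, productVec (Function.update (fun j => (x j : F)) i (h (x i)))

variable (S F)

/-- The algebraic tensor product of the system space `S` and the Fock space over `F`. -/
def AlgTotal : Type _ := S ⊗[ℂ] Fock F

instance : NormedAddCommGroup (AlgTotal S F) :=
  inferInstanceAs (NormedAddCommGroup (S ⊗[ℂ] Fock F))

instance : InnerProductSpace ℂ (AlgTotal S F) :=
  inferInstanceAs (InnerProductSpace ℂ (S ⊗[ℂ] Fock F))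

/-- The Hilbert space of system and bath: the Hilbert space tensor product of `S` and the
Fock space over `F`. -/
abbrev Total : Type _ := UniformSpace.Completion (AlgTotal S F)

variable {S F}

/-- The map `φ ↦ φ ⊗ Φ` into the algebraic tensor product. -/
def algKet (Φ : Fock F) : S →L[ℂ] AlgTotal S F := (TensorProduct.mkL ℂ S (Fock F)).flip Φ

/-- The map `φ ↦ φ ⊗ Φ` from the system space to the space of system and bath. -/
def ketCLM (Φ : Fock F) : S →L[ℂ] Total S F :=
  (UniformSpace.Completion.toComplL (𝕜 := ℂ) (E := AlgTotal S F)) ∘L algKet Φ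

/-- The vector `φ ⊗ Φ`. -/
def ket (φ : S) (Φ : Fock F) : Total S F := ketCLM Φ φ

theorem inner_ket (φ ψ : S) (Φ Θ : Fock F) :
    inner ℂ (ket φ Φ) (ket ψ Θ) = inner ℂ φ ψ * inner ℂ Φ Θ :=
  (UniformSpace.Completion.inner_coe _ _).trans (TensorProduct.inner_tmul ℂ φ ψ Φ Θ)

/-- The graph of `H₀ = I ⊗ dΓ(h)`, on the linear span of the vectors `φ ⊗ a(x₁)* ⋯ a(xₙ)* vac`
with `xᵢ` in the domain of `h`. -/
def freeHamiltonian (S : Type*) [NormedAddCommGroup S] [InnerProductSpace ℂ S]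
    (h : F →ₗ.[ℂ] F) : Submodule ℂ (Total S F × Total S F) :=
  Submodule.span ℂ {p | ∃ (φ : S) (n : ℕ) (x : Fin n → h.domain),
    p = (ket φ (productVec fun i => (x i : F)), ket φ (secondQuant h x))}

/-- The graph of `H_Tot = H ⊗ I + I ⊗ dΓ(h) + i L ⊗ a(g)* - i L* ⊗ a(g)`, on the linear span of
the vectors `φ ⊗ a(x₁)* ⋯ a(xₙ)* vac` with `xᵢ` in the domain of `h`. -/
def totalHamiltonian [CompleteSpace S] (H L : S →L[ℂ] S) (h : F →ₗ.[ℂ] F) (g : F) :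
    Submodule ℂ (Total S F × Total S F) :=
  Submodule.span ℂ {p | ∃ (φ : S) (n : ℕ) (x : Fin n → h.domain),
    p = (ket φ (productVec fun i => (x i : F)),
      ket (H φ) (productVec fun i => (x i : F)) + ket φ (secondQuant h x)
        + Complex.I • ket (L φ) (creation g fun i => (x i : F))
        - Complex.I • ket (ContinuousLinearMap.adjoint L φ)
            (annihilation g fun i => (x i : F)))}

/-- The interaction picture evolution `U_t = e^{it H₀} e^{-it H_Tot}`. -/
def evolution [CompleteSpace S] (H L : S →L[ℂ] S) (h : F →ₗ.[ℂ] F) (g : F) (t : ℝ) :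
    Total S F →L[ℂ] Total S F :=
  unitaryGroup (freeHamiltonian S h) (-t) ∘L unitaryGroup (totalHamiltonian H L h g) t

/-- The hybrid complex wave representation of `Ψ`: the function `f ↦ Ψ(f)` from the one-particle
space to the system space with `⟨ψ, Ψ(f)⟩ = ⟨ψ ⊗ e^f, Ψ⟩` for all `ψ`. -/
def hybrid [CompleteSpace S] (Ψ : Total S F) (f : F) : S :=
  ContinuousLinearMap.adjoint (ketCLM (S := S) (expVec f)) Ψ

theorem inner_hybrid [CompleteSpace S] (Ψ : Total S F) (f : F) (ψ : S) :
    inner ℂ ψ (hybrid Ψ f) = inner ℂ (ket ψ (expVec f)) Ψ := by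
  rw [hybrid, ContinuousLinearMap.adjoint_inner_right, ket]

/-! ### Complex trajectories -/

/-- The complex trajectory `ζ(f) : t ↦ ⟨f, g_t⟩` of `f` over the time set `T`, where
`g_t = e^{ith} g`; it is conjugate-linear in `f`. -/
def trajectory (h : F →ₗ.[ℂ] F) (g : F) (T : Set ℝ) : F →ₗ⋆[ℂ] (T → ℂ) where
  toFun f t := inner ℂ f (unitaryGroup h.graph (-(t : ℝ)) g)
  map_add' f f' := by ext t; exact inner_add_left _ _ _
  map_smul' c f := by ext t; exact inner_smul_left _ _ _

/-- The space of complex trajectories over `T`. -/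
def Trajectories (h : F →ₗ.[ℂ] F) (g : F) (T : Set ℝ) : Submodule ℂ (T → ℂ) :=
  LinearMap.range (trajectory h g T)

/-- The trajectory of `f`, as an element of the space of trajectories. -/
def trajectoryOf (h : F →ₗ.[ℂ] F) (g : F) (T : Set ℝ) (f : F) : Trajectories h g T :=
  ⟨trajectory h g T f, f, rfl⟩

/-- The hybrid complex wave representation as a function of the complex trajectory,
`Ψ(ζ) = Ψ(f_ζ)` with `ζ(f_ζ) = ζ`. -/
def hybridTraj [CompleteSpace S] (h : F →ₗ.[ℂ] F) (g : F) (T : Set ℝ) (Ψ : Total S F)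
    (z : Trajectories h g T) : S :=
  hybrid Ψ (LinearMap.mem_range.1 z.2).choose

/-- Lebesgue measure on a set of times. -/
def timeMeasure (T : Set ℝ) : Measure T := (volume : Measure ℝ).comap Subtype.val

/-- `D` is a functional derivative `τ ↦ δΦ/δζ_τ` at the trajectory `z` of the function `Φ`
on a linear space `C` of functions on `T`: for each variation `η` in `C`, the (complex) directional
derivative of `Φ` at `z` along `η` exists and is `∫_T η_τ D_τ dτ`. -/
structure HasFunctionalDeriv {T : Set ℝ} {C : Submodule ℂ (T → ℂ)} (Φ : C → S) (D : T → S)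
    (z : C) : Prop where
  locallyIntegrable : LocallyIntegrable D (timeMeasure T)
  integrable : ∀ η : C, Integrable (fun τ : T => (η : T → ℂ) τ • D τ) (timeMeasure T)
  hasDerivAt : ∀ η : C, HasDerivAt (fun ε : ℂ => Φ (z + ε • η))
    (∫ τ, (η : T → ℂ) τ • D τ ∂(timeMeasure T)) 0

end Model

end BathModel

end

/-! Write U_t = e^{itH_0} e^{-itH_Tot}, γ_s = e^{ish} g and Ω = φ ⊗ vac. In the interaction picture
the bath enters only through γ: on product vectors, d/dt U_t^* = U_t^* · i(H + iL⊗a(γ_t)^* −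
iL^*⊗a(γ_t)). Since a(k)Ω = 0 and [a(k), a(γ_s)^*] = ⟨k, γ_s⟩, Duhamel's formula gives a(k) U_t Ω =
∫_0^t ⟨k, γ_s⟩ U_t U_s^* (L⊗1) U_s Ω ds, which is `inner_creation_evolution` in weak form.

The derivative of e^f along k is a(k)^* e^f. Pairing it with U_t Ω, the derivative of the hybrid
representation at f along k is ∫_0^t ⟨k, γ_s⟩ D_s ds with D_s independent of k
(`exists_hasDerivAt_hybrid_evolution`). Only the trajectory of k over [0,t] is seen. If it vanishes
there, the representation is constant along the line f + εk (`hybrid_evolution_congr`); this gives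
the first two claims. D cut off to [0,t] is the functional derivative of the third.

The rest justifies this for unbounded operators. `unitaryGroup` means something only once a group
with the given generator exists, so existence is proved for h (Stone, `exists_isGroupOf_graph`), for
H_0 (second quantization, `unitaryGroup_freeHamiltonian`) and for H_Tot (Dyson series,
`exists_isGroupOf_totalHamiltonian`). To avoid domain questions, evolutions are treated as functions
Z(ψ, n, x) of product vectors, with the interaction acting on the argument. The key tool is
uniqueness, `eq_zero_of_hasDerivAt_interaction`: N interactions create at most N particles and cost
√((n+p+N)!), while N time integrations gain 1/N!, so iterating the equation forces a solution
starting at zero to vanish. The same balance makes the Dyson series converge. -/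

noncomputable section

namespace BathModel
open Filter

/-! ### Stone's theorem, by bounded approximation of a self-adjoint operator. -/

section Stone

variable {E : Type*} [NormedAddCommGroup E] [InnerProductSpace ℂ E] [CompleteSpace E]

/-- The unitary group `e^{-itB}` of a bounded operator `B`. -/
def boundedGroup (B : E →L[ℂ] E) (t : ℝ) : E →L[ℂ] E :=
  NormedSpace.exp (t • (-Complex.I • B))

theorem boundedGroup_zero (B : E →L[ℂ] E) : boundedGroup B 0 = 1 := by
  simp [boundedGroup]

theorem boundedGroup_add (B : E →L[ℂ] E) (s t : ℝ) :
    boundedGroup B (s + t) = boundedGroup B s * boundedGroup B t := by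
  let +nondep : NormedAlgebra ℚ (E →L[ℂ] E) := .restrictScalars ℚ ℂ _
  unfold boundedGroup
  rw [add_smul, NormedSpace.exp_add_of_commute]
  exact ((Commute.refl _).smul_left _).smul_right _

theorem boundedGroup_eq_mul {A B : E →L[ℂ] E} (h : Commute A B) (t : ℝ) :
    boundedGroup A t = boundedGroup B t * boundedGroup (A - B) t := by
  let +nondep : NormedAlgebra ℚ (E →L[ℂ] E) := .restrictScalars ℚ ℂ _
  unfold boundedGroup
  rw [← NormedSpace.exp_add_of_commute]
  · congr 1
    rw [← smul_add, ← smul_add, add_sub_cancel]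
  · exact ((((h.symm.sub_right (Commute.refl B)).smul_left _).smul_right _).smul_left _).smul_right _

theorem norm_boundedGroup {B : E →L[ℂ] E} (hB : IsSelfAdjoint B) (t : ℝ) (x : E) :
    ‖boundedGroup B t x‖ = ‖x‖ := by
  let +nondep : NormedAlgebra ℚ (E →L[ℂ] E) := .restrictScalars ℚ ℂ _
  have h : boundedGroup B t ∈ unitary (E →L[ℂ] E) := by
    apply NormedSpace.exp_mem_unitary_of_mem_skewAdjoint
    rw [skewAdjoint.mem_iff, star_smul, star_smul, hB.star_eq]
    simp
  exact ContinuousLinearMap.norm_map_of_mem_unitary h x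

theorem hasDerivAt_boundedGroup (B : E →L[ℂ] E) (x : E) (t : ℝ) :
    HasDerivAt (fun s => boundedGroup B s x) (boundedGroup B t (-Complex.I • B x)) t := by
  let +nondep : NormedAlgebra ℚ (E →L[ℂ] E) := .restrictScalars ℚ ℂ _
  have h := hasDerivAt_exp_smul_const (𝕂 := ℝ) (-Complex.I • B) t
  exact (((ContinuousLinearMap.apply ℂ E x).restrictScalars ℝ).hasFDerivAt.comp_hasDerivAt t h)

theorem norm_sub_le_of_hasDerivAt {G : Type*} [NormedAddCommGroup G] [NormedSpace ℝ G]
    {f f' : ℝ → G} {C t : ℝ} (hf : ∀ s, HasDerivAt f (f' s) s)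
    (hC : ∀ s, |s| ≤ |t| → ‖f' s‖ ≤ C) : ‖f t - f 0‖ ≤ C * |t| := by
  have := (convex_Icc (-|t|) |t|).norm_image_sub_le_of_norm_hasDerivWithin_le
    (f := f) (f' := f') (C := C) (x := 0) (y := t)
    (fun s _ => (hf s).hasDerivWithinAt) (fun s hs => hC s (abs_le.2 hs))
    ⟨by simp, by simp⟩ ⟨neg_abs_le t, le_abs_self t⟩
  simpa using this

theorem norm_boundedGroup_sub_le {B : E →L[ℂ] E} (hB : IsSelfAdjoint B) (t : ℝ) (x : E) :
    ‖boundedGroup B t x - x‖ ≤ ‖B x‖ * |t| := by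
  have := norm_sub_le_of_hasDerivAt (t := t) (C := ‖B x‖) (hasDerivAt_boundedGroup B x)
    (fun s _ => by rw [norm_boundedGroup hB, norm_smul, norm_neg, Complex.norm_I, one_mul])
  simpa [boundedGroup_zero] using this

/-- Commutativity allows the factorization e^{-itA} = e^{-itB} e^{-it(A-B)}, whose first factor is
isometric. -/
theorem norm_boundedGroup_sub_sub_le {A B : E →L[ℂ] E} (hA : IsSelfAdjoint A)
    (hB : IsSelfAdjoint B) (h : Commute A B) (t : ℝ) (x : E) :
    ‖boundedGroup A t x - boundedGroup B t x‖ ≤ ‖A x - B x‖ * |t| := by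
  rw [boundedGroup_eq_mul h, mul_apply_eq_comp, ← map_sub, norm_boundedGroup hB]
  exact norm_boundedGroup_sub_le (hA.sub hB) t x

/-- The bound never involves ‖B‖, so it survives B → A with A unbounded: y plays the role of Ax, and
z is a vector of the domain close to y, on which the group moves slowly. -/
theorem norm_boundedGroup_taylor_le {B : E →L[ℂ] E} (hB : IsSelfAdjoint B) (t : ℝ) (x y z : E) :
    ‖boundedGroup B t x - x + (t * Complex.I) • y‖ ≤
      (‖B x - y‖ + 2 * ‖y - z‖ + ‖B z‖ * |t|) * |t| := by
  have h := norm_sub_le_of_hasDerivAt (t := t) (C := ‖B x - y‖ + 2 * ‖y - z‖ + ‖B z‖ * |t|)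
    (f := fun s => boundedGroup B s x + (s * Complex.I) • y)
    (f' := fun s => boundedGroup B s (-Complex.I • B x) + (1 * Complex.I) • y)
    (fun s => (hasDerivAt_boundedGroup B x s).add
      ((((hasDerivAt_id s).ofReal_comp).mul_const Complex.I).smul_const y)) ?_
  · simpa [boundedGroup_zero, add_sub_right_comm] using h
  · intro s hs
    have e : boundedGroup B s (-Complex.I • B x) + (1 * Complex.I) • y =
        -Complex.I • (boundedGroup B s (B x - y) + boundedGroup B s (y - z) +
          (boundedGroup B s z - z) + (z - y)) := by
      simp only [map_smul, map_sub, one_mul]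
      module
    rw [e, norm_smul, norm_neg, Complex.norm_I, one_mul]
    have h1 := norm_boundedGroup_sub_le hB s z
    have h2 : ‖B z‖ * |s| ≤ ‖B z‖ * |t| := by gcongr
    have h3 := norm_add₃_le (a := boundedGroup B s (B x - y)) (b := boundedGroup B s (y - z))
      (c := boundedGroup B s z - z)
    have h4 := norm_add_le (boundedGroup B s (B x - y) + boundedGroup B s (y - z) +
          (boundedGroup B s z - z)) (z - y)
    rw [norm_boundedGroup hB, norm_boundedGroup hB] at h3
    rw [norm_sub_rev z y] at h4
    linarith

/-- An operator that is approximated by commuting bounded self-adjoint operators generates a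
unitary group. -/
theorem exists_isGroupOf_of_approx (A : Submodule ℂ (E × E)) (B : ℕ → E →L[ℂ] E)
    (hB : ∀ n, IsSelfAdjoint (B n)) (hc : ∀ m n, Commute (B m) (B n))
    (hd : Dense {x | ∃ y, (x, y) ∈ A})
    (hle : ∀ p ∈ A, ∀ n, ‖B n p.1‖ ≤ ‖p.2‖)
    (hlim : ∀ p ∈ A, Tendsto (fun n => B n p.1) atTop (𝓝 p.2)) :
    ∃ V, IsGroupOf A V := by
  -- On the domain of A the groups are Cauchy because the vectors B_n z are; isometry carries this
  -- over to every x.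
  have hcauchy : ∀ t x, CauchySeq fun n => boundedGroup (B n) t x := by
    intro t x
    rw [Metric.cauchySeq_iff]
    intro ε hε
    obtain ⟨z, ⟨y, hy⟩, hz⟩ := hd.exists_dist_lt x (ε := ε / 4) (by positivity)
    have h1 := (hlim _ hy).cauchySeq
    rw [Metric.cauchySeq_iff] at h1
    obtain ⟨N, hN⟩ := h1 (ε / (4 * (|t| + 1))) (by positivity)
    refine ⟨N, fun m hm n hn => ?_⟩
    have h2 := hN m hm n hn
    rw [dist_eq_norm] at h2 hz ⊢
    have h3 := norm_boundedGroup_sub_sub_le (hB m) (hB n) (hc m n) t z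
    have h4 : ‖B m z - B n z‖ * |t| ≤ ε / 4 := by
      have : ‖B m z - B n z‖ * |t| ≤ ε / (4 * (|t| + 1)) * (|t| + 1) := by
        gcongr
        linarith
      refine this.trans (le_of_eq ?_)
      field_simp
    have e : boundedGroup (B m) t x - boundedGroup (B n) t x =
        boundedGroup (B m) t (x - z) - boundedGroup (B n) t (x - z) +
          (boundedGroup (B m) t z - boundedGroup (B n) t z) := by
      simp only [map_sub]
      abel
    rw [e]
    refine (norm_add_le _ _).trans_lt ?_
    have h5 := norm_sub_le (boundedGroup (B m) t (x - z)) (boundedGroup (B n) t (x - z))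
    rw [norm_boundedGroup (hB m), norm_boundedGroup (hB n)] at h5
    linarith
  choose f hf using fun t x => cauchySeq_tendsto_of_complete (hcauchy t x)
  let V : ℝ → E →L[ℂ] E := fun t =>
    continuousLinearMapOfTendsto (fun n => boundedGroup (B n) t) (f := f t) (tendsto_pi_nhds.2 (hf t))
  have hV : ∀ t x, Tendsto (fun n => boundedGroup (B n) t x) atTop (𝓝 (V t x)) := hf
  have hnorm : ∀ t x, ‖V t x‖ = ‖x‖ := fun t x =>
    tendsto_nhds_unique (hV t x).norm (by simp [norm_boundedGroup (hB _)])
  have hadd : ∀ s t x, V (s + t) x = V s (V t x) := by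
    intro s t x
    refine tendsto_nhds_unique (hV (s + t) x) ?_
    rw [tendsto_iff_norm_sub_tendsto_zero]
    have h1 : Tendsto (fun n => ‖boundedGroup (B n) t x - V t x‖ +
        ‖boundedGroup (B n) s (V t x) - V s (V t x)‖) atTop (𝓝 (0 + 0)) :=
      (tendsto_iff_norm_sub_tendsto_zero.1 (hV t x)).add
        (tendsto_iff_norm_sub_tendsto_zero.1 (hV s (V t x)))
    rw [add_zero] at h1
    refine squeeze_zero (fun _ => norm_nonneg _) (fun n => ?_) h1
    rw [boundedGroup_add, mul_apply_eq_comp]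
    calc _ = ‖boundedGroup (B n) s (boundedGroup (B n) t x - V t x) +
        (boundedGroup (B n) s (V t x) - V s (V t x))‖ := by simp
      _ ≤ _ := by
        refine (norm_add_le _ _).trans ?_
        rw [norm_boundedGroup (hB n)]
  have hzero : V 0 = 1 := by
    ext x
    refine tendsto_nhds_unique (hV 0 x) ?_
    simp [boundedGroup_zero]
  -- The vector p.2 need not lie in the domain, so q.1 approximates it there; `hle` makes the
  -- estimate uniform in n.
  have htaylor : ∀ p ∈ A, ∀ q ∈ A, ∀ t : ℝ, ‖V t p.1 - p.1 + (t * Complex.I) • p.2‖ ≤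
      (2 * ‖p.2 - q.1‖ + ‖q.2‖ * |t|) * |t| := by
    intro p hp q hq t
    have h1 : Tendsto (fun n => (‖B n p.1 - p.2‖ + 2 * ‖p.2 - q.1‖ + ‖q.2‖ * |t|) * |t|) atTop
        (𝓝 ((0 + 2 * ‖p.2 - q.1‖ + ‖q.2‖ * |t|) * |t|)) :=
      (((tendsto_iff_norm_sub_tendsto_zero.1 (hlim p hp)).add_const _).add_const _).mul_const _
    rw [zero_add] at h1
    refine le_of_tendsto_of_tendsto (((hV t p.1).sub_const _).add_const _).norm h1
      (Eventually.of_forall fun n => (norm_boundedGroup_taylor_le (hB n) t p.1 p.2 q.1).trans ?_)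
    have := hle q hq n
    simp only
    gcongr
  have hderiv : ∀ p ∈ A, HasDerivAt (fun t => V t p.1) (-Complex.I • p.2) 0 := by
    intro p hp
    rw [hasDerivAt_iff_isLittleO, Asymptotics.isLittleO_iff]
    intro c hc
    obtain ⟨z, ⟨y, hy⟩, hz⟩ := hd.exists_dist_lt p.2 (ε := c / 4) (by positivity)
    have h0 : ∀ᶠ t : ℝ in 𝓝 0, |t| < c / (2 * (‖y‖ + 1)) := by
      have : Tendsto (fun t : ℝ => |t|) (𝓝 0) (𝓝 |0|) := continuous_abs.tendsto 0
      rw [abs_zero] at this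
      exact this.eventually_lt_const (by positivity)
    filter_upwards [h0] with t ht
    have h1 := htaylor p hp _ hy t
    rw [dist_eq_norm] at hz
    have h2 : ‖y‖ * |t| ≤ c / 2 := by
      have : ‖y‖ * |t| ≤ (‖y‖ + 1) * (c / (2 * (‖y‖ + 1))) := by
        gcongr
        linarith
      refine this.trans (le_of_eq ?_)
      field_simp
    have e : V t p.1 - V 0 p.1 - (t - 0) • (-Complex.I • p.2) =
        V t p.1 - p.1 + (t * Complex.I) • p.2 := by
      rw [hzero, sub_zero, ← Complex.coe_smul t, smul_smul]
      simp only [one_apply_eq_self]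
      module
    rw [e, sub_zero, Real.norm_eq_abs]
    refine h1.trans ?_
    gcongr
    linarith
  have hcont0 : ∀ x, ContinuousAt (fun t => V t x) 0 := by
    intro x
    rw [Metric.continuousAt_iff']
    intro ε hε
    obtain ⟨z, ⟨y, hy⟩, hz⟩ := hd.exists_dist_lt x (ε := ε / 3) (by positivity)
    have h1 := Metric.continuousAt_iff'.1 (hderiv _ hy).continuousAt (ε / 3) (by positivity)
    filter_upwards [h1] with t ht
    rw [dist_eq_norm] at ht hz ⊢
    have e : V t x - V 0 x = V t (x - z) + (V t z - V 0 z) - (x - z) := by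
      simp only [map_sub, hzero, one_apply_eq_self]
      abel
    rw [e]
    have h2 := norm_sub_le (V t (x - z) + (V t z - V 0 z)) (x - z)
    have h3 := norm_add_le (V t (x - z)) (V t z - V 0 z)
    rw [hnorm] at h3
    linarith
  refine ⟨V, ⟨hzero, fun s t => by ext x; exact hadd s t x, hnorm, fun x => ?_⟩, hderiv⟩
  rw [continuous_iff_continuousAt]
  intro s
  have h1 : ContinuousAt (fun t => V s (V (t - s) x)) s := by
    refine (V s).continuous.continuousAt.comp ?_
    refine ContinuousAt.comp (g := fun t => V t x) (f := fun t => t - s) ?_ (by fun_prop)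
    rw [sub_self]
    exact hcont0 x
  refine h1.congr (Eventually.of_forall fun t => ?_)
  simp only
  rw [← hadd, add_sub_cancel]

theorem inner_apply_self_adjoint {h : E →ₗ.[ℂ] E} (hh : IsSelfAdjoint h) (x y : h.domain) :
    inner ℂ (h x) (y : E) = inner ℂ (x : E) (h y) := by
  have := LinearPMap.adjoint_isFormalAdjoint hh.dense_domain
  rw [LinearPMap.isSelfAdjoint_def.1 hh] at this
  exact this x y

/-- This is the maximality of the domain in h = h^*. It serves to show that resolvents are
everywhere defined and that the group preserves the domain. -/
theorem mem_domain_of_inner_eq {h : E →ₗ.[ℂ] E} (hh : IsSelfAdjoint h) (y z : E)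
    (hy : ∀ x : h.domain, inner ℂ z (x : E) = inner ℂ y (h x)) :
    ∃ hy : y ∈ h.domain, h ⟨y, hy⟩ = z := by
  have hA := LinearPMap.isSelfAdjoint_def.1 hh
  have h1 : y ∈ h.adjoint.domain := LinearPMap.mem_adjoint_domain_of_exists y ⟨z, hy⟩
  have h2 : h.adjoint ⟨y, h1⟩ = z := LinearPMap.adjoint_apply_eq hh.dense_domain ⟨y, h1⟩ hy
  have h3 : (y, z) ∈ h.adjoint.graph := by
    rw [LinearPMap.mem_graph_iff]
    exact ⟨⟨y, h1⟩, rfl, h2⟩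
  rw [hA, LinearPMap.mem_graph_iff] at h3
  obtain ⟨w, hw, hw'⟩ := h3
  simp only at hw hw'
  subst hw
  exact ⟨w.2, hw'⟩

/-- The cross term drops out because ⟨x, hx⟩ is real. -/
theorem norm_sq_add_smul {h : E →ₗ.[ℂ] E} (hh : IsSelfAdjoint h) (c : ℝ) (x : h.domain) :
    ‖(x : E) + (Complex.I * c) • h x‖ ^ 2 = ‖(x : E)‖ ^ 2 + c ^ 2 * ‖h x‖ ^ 2 := by
  have h1 := norm_add_sq (𝕜 := ℂ) (x : E) ((Complex.I * c) • h x)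
  have h2 : (inner ℂ (x : E) (h x)).im = 0 := by
    rw [← Complex.conj_eq_iff_im, inner_conj_symm, inner_apply_self_adjoint hh]
  rw [h1, norm_smul, inner_smul_right]
  simp [h2, mul_pow]

/-- The resolvent `(1 + ich)⁻¹` of a self-adjoint operator. -/
theorem exists_resolvent {h : E →ₗ.[ℂ] E} (hh : IsSelfAdjoint h) (c : ℝ) (hc : c ≠ 0) :
    ∃ J : E →L[ℂ] E, (∀ y, ∃ x : h.domain, J y = x ∧ (x : E) + (Complex.I * c) • h x = y) ∧
      (∀ x : h.domain, J (x + (Complex.I * c) • h x) = x) ∧ ∀ y, ‖J y‖ ≤ ‖y‖ := by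
  let T : h.domain →ₗ[ℂ] E := h.domain.subtype + (Complex.I * c) • h.toFun
  have hT : ∀ x, T x = (x : E) + (Complex.I * c) • h x := fun x => rfl
  have hsq : ∀ x, ‖T x‖ ^ 2 = ‖(x : E)‖ ^ 2 + c ^ 2 * ‖h x‖ ^ 2 := norm_sq_add_smul hh c
  have hle : ∀ x : h.domain, ‖(x : E)‖ ≤ ‖T x‖ := fun x => by
    rw [← pow_le_pow_iff_left₀ (norm_nonneg _) (norm_nonneg _) two_ne_zero, hsq]
    have : 0 ≤ c ^ 2 * ‖h x‖ ^ 2 := by positivity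
    linarith
  have hle2 : ∀ x, ‖h x‖ ≤ |c|⁻¹ * ‖T x‖ := fun x => by
    rw [inv_mul_eq_div, le_div_iff₀ (by positivity),
      ← pow_le_pow_iff_left₀ (by positivity) (norm_nonneg _) two_ne_zero, hsq, mul_pow, sq_abs]
    nlinarith [sq_nonneg ‖(x : E)‖]
  have hinj : Function.Injective T := by
    rw [injective_iff_map_eq_zero]
    intro x hx
    have := hle x
    rw [hx, norm_zero, norm_le_zero_iff] at this
    exact_mod_cast this
  -- T factors through the graph of h, which is complete, and (x, hx) ↦ x + ic hx is bounded below
  -- there.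
  have hclosed : IsClosed (LinearMap.range T : Set E) := by
    let S : h.graph →L[ℂ] E := (ContinuousLinearMap.fst ℂ E E +
      (Complex.I * c) • ContinuousLinearMap.snd ℂ E E) ∘L h.graph.subtypeL
    have : CompleteSpace h.graph := hh.isClosed.completeSpace_coe
    have hS : (LinearMap.range T : Set E) = Set.range S := by
      ext y
      constructor
      · rintro ⟨x, rfl⟩
        exact ⟨⟨(x, h x), h.mem_graph x⟩, rfl⟩
      · rintro ⟨⟨p, hp⟩, rfl⟩
        obtain ⟨x, hx, hx'⟩ := (LinearPMap.mem_graph_iff _).1 hp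
        refine ⟨x, ?_⟩
        simp [hT, S, hx, hx']
    rw [hS]
    have hb : ∀ p, ‖p‖ ≤ (Real.toNNReal (max 1 |c|⁻¹)) * ‖S p‖ := by
      rintro ⟨p, hp⟩
      obtain ⟨x, hx, hx'⟩ := (LinearPMap.mem_graph_iff _).1 hp
      have hSx : S ⟨p, hp⟩ = T x := by simp [hT, S, hx, hx']
      rw [hSx, Real.coe_toNNReal _ (by positivity)]
      change ‖p‖ ≤ _
      rw [Prod.norm_def, ← hx, ← hx', max_le_iff]
      constructor
      · refine (hle x).trans (le_mul_of_one_le_left (norm_nonneg _) (le_max_left _ _))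
      · refine (hle2 x).trans ?_
        gcongr
        exact le_max_right _ _
    exact (S.antilipschitz_of_bound hb).isClosed_range S.uniformContinuous
  have hsurj : Function.Surjective T := by
    rw [← LinearMap.range_eq_top]
    have h1 : (LinearMap.range T).topologicalClosure = LinearMap.range T :=
      IsClosed.submodule_topologicalClosure_eq hclosed
    rw [← h1, Submodule.topologicalClosure_eq_top_iff, Submodule.eq_bot_iff]
    intro y hy
    -- A vector y orthogonal to the range would be an eigenvector of h with the non-real eigenvalue
    -- −i/c.
    have h2 : ∀ x : h.domain, inner ℂ ((-Complex.I * (c : ℂ)⁻¹) • y) (x : E) =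
        inner ℂ y (h x) := by
      intro x
      have h3 := (Submodule.mem_orthogonal' _ _).1 hy _ ⟨x, rfl⟩
      rw [hT, inner_add_right, inner_smul_right] at h3
      have hc' : (c : ℂ) ≠ 0 := by exact_mod_cast hc
      rw [inner_smul_left]
      simp only [map_mul, map_neg, Complex.conj_I, map_inv₀, Complex.conj_ofReal, neg_neg]
      rw [eq_neg_of_add_eq_zero_left h3]
      linear_combination (-(Complex.I ^ 2) * inner ℂ y (h x)) * (inv_mul_cancel₀ hc') -
        inner ℂ y (h x) * Complex.I_sq
    obtain ⟨hy', h4⟩ := mem_domain_of_inner_eq hh y _ h2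
    have h5 := inner_apply_self_adjoint hh ⟨y, hy'⟩ ⟨y, hy'⟩
    rw [h4, inner_smul_left, inner_smul_right] at h5
    simp only [map_mul, map_neg, Complex.conj_I, map_inv₀, Complex.conj_ofReal, neg_neg] at h5
    have hc' : (c : ℂ) ≠ 0 := by exact_mod_cast hc
    have h6 : 2 * Complex.I * (c : ℂ)⁻¹ * inner ℂ y y = 0 := by linear_combination h5
    simpa [hc'] using h6
  let e := LinearEquiv.ofBijective T ⟨hinj, hsurj⟩
  have he : ∀ x, e x = T x := fun _ => rfl
  refine ⟨(h.domain.subtype ∘ₗ e.symm.toLinearMap).mkContinuous 1 fun y => ?_, fun y => ?_,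
    fun x => ?_, fun y => ?_⟩
  · rw [one_mul]
    have := hle (e.symm y)
    rwa [← he, e.apply_symm_apply] at this
  · exact ⟨e.symm y, rfl, e.apply_symm_apply y⟩
  · exact congrArg Subtype.val (e.symm_apply_apply x)
  · have := hle (e.symm y)
    rwa [← he, e.apply_symm_apply] at this

/-- Stone's theorem: a self-adjoint operator generates a unitary group. -/
theorem exists_isGroupOf_graph {h : E →ₗ.[ℂ] E} (hh : IsSelfAdjoint h) :
    ∃ V, IsGroupOf h.graph V := by
  choose! J hJ hJ' hJn using exists_resolvent hh
  have hsub : ∀ c ≠ 0, ∀ x : h.domain, (x : E) - J c x = (Complex.I * c) • J c (h x) := by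
    intro c hc x
    have := hJ' c hc x
    rw [map_add, map_smul] at this
    exact sub_eq_of_eq_add' this.symm
  have hdom : ∀ c ≠ 0, ∀ x : h.domain, ∃ w : h.domain, J c x = w ∧ h w = J c (h x) := by
    intro c hc x
    obtain ⟨w, hw, hw'⟩ := hJ c hc x
    refine ⟨w, hw, ?_⟩
    have hc' : Complex.I * c ≠ 0 := mul_ne_zero Complex.I_ne_zero (by exact_mod_cast hc)
    refine smul_right_injective E hc' ?_
    simp only
    rw [← hsub c hc, hw, eq_sub_iff_add_eq', hw']
  have hcomm : ∀ c ≠ 0, ∀ d ≠ 0, Commute (J c) (J d) := by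
    intro c hc d hd
    ext y
    simp only [mul_apply_eq_comp]
    obtain ⟨w, hw, hw'⟩ := hJ c hc y
    obtain ⟨v, hv, hv'⟩ := hdom d hd w
    rw [hw, hv, ← hJ' c hc v, hv', ← hv, ← map_smul, ← map_add, hw']
  have hadj : ∀ c ≠ 0, (J c).adjoint = J (-c) := by
    intro c hc
    symm
    rw [ContinuousLinearMap.eq_adjoint_iff]
    intro y z
    obtain ⟨w, hw, hw'⟩ := hJ (-c) (neg_ne_zero.2 hc) y
    obtain ⟨v, hv, hv'⟩ := hJ c hc z
    rw [hw, hv, ← hw', ← hv', inner_add_left, inner_add_right, inner_smul_left,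
      inner_smul_right, inner_apply_self_adjoint hh]
    simp
  have hone : ∀ c : ℕ → ℝ, (∀ n, c n ≠ 0) → Tendsto c atTop (𝓝 0) → ∀ y,
      Tendsto (fun n => J (c n) y) atTop (𝓝 y) := by
    intro c hc hlim y
    rw [Metric.tendsto_atTop']
    intro ε hε
    obtain ⟨z, hz, hyz⟩ := hh.dense_domain.exists_dist_lt y (ε := ε / 3) (by positivity)
    have h1 : ∀ᶠ n in atTop, |c n| * ‖h ⟨z, hz⟩‖ < ε / 3 := by
      have := hlim.abs.mul_const ‖h ⟨z, hz⟩‖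
      rw [abs_zero, zero_mul] at this
      exact this.eventually_lt_const (by positivity)
    obtain ⟨N, hN⟩ := eventually_atTop.1 h1
    refine ⟨N, fun n hn => ?_⟩
    have h2 := hsub (c n) (hc n) ⟨z, hz⟩
    have h3 : ‖z - J (c n) z‖ ≤ |c n| * ‖h ⟨z, hz⟩‖ := by
      change z - J (c n) z = _ at h2
      rw [h2, norm_smul]
      simp only [norm_mul, Complex.norm_I, one_mul, Complex.norm_real, Real.norm_eq_abs]
      gcongr
      exact hJn _ (hc n) _
    rw [dist_eq_norm] at hyz ⊢
    have e : J (c n) y - y = J (c n) (y - z) - (z - J (c n) z) - (y - z) := by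
      rw [map_sub]
      abel
    rw [e]
    have h4 := norm_sub_le (J (c n) (y - z) - (z - J (c n) z)) (y - z)
    have h5 := norm_sub_le (J (c n) (y - z)) (z - J (c n) z)
    have h6 := hJn _ (hc n) (y - z)
    have h7 := hN n hn.le
    linarith
  let c : ℕ → ℝ := fun n => 1 / ((n : ℝ) + 1)
  have hc : ∀ n, c n ≠ 0 := fun n => by positivity
  have hclim : Tendsto c atTop (𝓝 0) := tendsto_one_div_add_atTop_nhds_zero_nat
  have hc2 : ∀ n, (c n : ℂ) ≠ 0 := fun n => by exact_mod_cast hc n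
  -- With J(c) = (1 + ich)^{-1} this is h(1 + c²h²)^{-1}. On the domain it is the average of J(c)hx
  -- and J(−c)hx, which gives both the bound by ‖hx‖ and the convergence to hx.
  let B : ℕ → E →L[ℂ] E := fun n => (2 * Complex.I * c n)⁻¹ • (J (-c n) - J (c n))
  have hBx : ∀ (x : h.domain) n, B n x = (2 : ℂ)⁻¹ • (J (c n) (h x) + J (-c n) (h x)) := by
    intro x n
    have h1 := hsub (c n) (hc n) x
    have h2 := hsub (-c n) (neg_ne_zero.2 (hc n)) x
    have e : J (-c n) (x : E) - J (c n) x = (x - J (c n) x) - (x - J (-c n) x) := by abel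
    simp only [B, smul_apply, sub_apply]
    rw [e, h1, h2, Complex.ofReal_neg, mul_neg, neg_smul, sub_neg_eq_add, ← smul_add, smul_smul]
    congr 1
    have := hc2 n
    field_simp
  refine exists_isGroupOf_of_approx h.graph B (fun n => ?_) (fun m n => ?_) ?_ ?_ ?_
  · rw [ContinuousLinearMap.isSelfAdjoint_iff']
    simp only [B, map_smulₛₗ, map_sub]
    rw [hadj _ (hc n), hadj _ (neg_ne_zero.2 (hc n)), neg_neg, ← neg_sub, smul_neg, ← neg_smul]
    congr 1
    simp only [map_inv₀, map_mul, Complex.conj_I, Complex.conj_ofReal, Complex.conj_ofNat, mul_neg,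
      neg_mul, inv_neg, neg_neg]
  · have h1 := hcomm _ (hc m) _ (hc n)
    have h2 := hcomm _ (hc m) _ (neg_ne_zero.2 (hc n))
    have h3 := hcomm _ (neg_ne_zero.2 (hc m)) _ (hc n)
    have h4 := hcomm _ (neg_ne_zero.2 (hc m)) _ (neg_ne_zero.2 (hc n))
    exact (((h4.sub_right h3).sub_left (h2.sub_right h1)).smul_left _).smul_right _
  · refine hh.dense_domain.mono fun x hx => ⟨h ⟨x, hx⟩, h.mem_graph ⟨x, hx⟩⟩
  · intro p hp n
    obtain ⟨x, hx, hx'⟩ := (LinearPMap.mem_graph_iff _).1 hp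
    rw [← hx, ← hx', hBx, norm_smul]
    have h1 := norm_add_le (J (c n) (h x)) (J (-c n) (h x))
    have h2 := hJn _ (hc n) (h x)
    have h3 := hJn _ (neg_ne_zero.2 (hc n)) (h x)
    norm_num
    linarith
  · intro p hp
    obtain ⟨x, hx, hx'⟩ := (LinearPMap.mem_graph_iff _).1 hp
    rw [← hx, ← hx']
    simp only [hBx]
    have h1 := hone c hc hclim (h x)
    have h2 := hone (fun n => -c n) (fun n => neg_ne_zero.2 (hc n)) (by simpa using hclim.neg) (h x)
    have h3 := (h1.add h2).const_smul (2 : ℂ)⁻¹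
    rwa [← two_smul ℂ (h x), smul_smul, inv_mul_cancel₀ two_ne_zero, one_smul] at h3

end Stone

/-! ### Calculus of unitary groups; isometries determined on total families. -/

section GroupLemmas

variable {E : Type*} [NormedAddCommGroup E] [InnerProductSpace ℂ E]

theorem IsUnitaryGroup.neg_apply_apply {V : ℝ → E →L[ℂ] E} (hV : IsUnitaryGroup V) (t : ℝ) (x : E) :
    V (-t) (V t x) = x := by
  have h := hV.map_add (-t) t
  rw [neg_add_cancel, hV.map_zero] at h
  exact (DFunLike.congr_fun h x).symm

theorem IsUnitaryGroup.apply_neg_apply {V : ℝ → E →L[ℂ] E} (hV : IsUnitaryGroup V) (t : ℝ) (x : E) :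
    V t (V (-t) x) = x := by
  simpa using hV.neg_apply_apply (-t) x

theorem IsUnitaryGroup.map_add_apply {V : ℝ → E →L[ℂ] E} (hV : IsUnitaryGroup V) (s t : ℝ) (x : E) :
    V (s + t) x = V s (V t x) := by
  rw [hV.map_add, ContinuousLinearMap.comp_apply]

theorem inner_map_map_of_norm_map {U : E →L[ℂ] E} (hU : ∀ x, ‖U x‖ = ‖x‖) (x y : E) :
    inner ℂ (U x) (U y) = inner ℂ x y :=
  LinearIsometry.inner_map_map (⟨U.toLinearMap, hU⟩ : E →ₗᵢ[ℂ] E) x y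

theorem IsUnitaryGroup.inner_apply_left {V : ℝ → E →L[ℂ] E} (hV : IsUnitaryGroup V) (t : ℝ) (x y : E) :
    inner ℂ (V t x) y = inner ℂ x (V (-t) y) := by
  rw [← inner_map_map_of_norm_map (hV.norm_map t) x (V (-t) y), hV.apply_neg_apply]

/-- The product rule for a strongly differentiable family of isometries. -/
theorem hasDerivAt_apply_of_norm_map {A : ℝ → E →L[ℂ] E} (hA : ∀ t x, ‖A t x‖ = ‖x‖)
    {u : ℝ → E} {u' a' : E} {s : ℝ} (hu : HasDerivAt u u' s)
    (hAu : HasDerivAt (fun r => A r (u s)) a' s) (hc : ContinuousAt (fun r => A r u') s) :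
    HasDerivAt (fun r => A r (u r)) (A s u' + a') s := by
  -- Isometry keeps the remainder of u equally small after applying A r, so strong differentiability
  -- at u s is enough and no operator-norm regularity enters.
  have h1 : HasDerivAt (fun r => A r (u r - u s - (r - s) • u')) 0 s := by
    rw [hasDerivAt_iff_isLittleO] at hu ⊢
    refine Asymptotics.IsLittleO.congr_left (f₁ := fun r => A r (u r - u s - (r - s) • u')) ?_
      (by simp)
    rw [← Asymptotics.isLittleO_norm_left] at hu ⊢
    simpa only [hA] using hu
  have h2 : HasDerivAt (fun r => (r - s) • A r u') (A s u') s := by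
    rw [hasDerivAt_iff_tendsto_slope]
    have h3 : Tendsto (fun r => A r u') (𝓝[≠] s) (𝓝 (A s u')) := hc.tendsto.mono_left nhdsWithin_le_nhds
    refine h3.congr' ?_
    filter_upwards [self_mem_nhdsWithin] with r hr
    have : r - s ≠ 0 := sub_ne_zero.2 hr
    rw [slope_def_module, sub_self, zero_smul, sub_zero, smul_smul, inv_mul_cancel₀ this, one_smul]
  have h4 := (h1.add h2).add hAu
  rw [zero_add] at h4
  refine h4.congr_of_eventuallyEq (Eventually.of_forall fun r => ?_)
  simp only [Pi.add_apply, map_sub, ContinuousLinearMap.map_smul_of_tower]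
  abel

theorem IsGroupOf.hasDerivAt_apply {A : Submodule ℂ (E × E)} {V : ℝ → E →L[ℂ] E}
    (hV : IsGroupOf A V) {p : E × E} (hp : p ∈ A) (s : ℝ) :
    HasDerivAt (fun t => V t p.1) (V s (-Complex.I • p.2)) s := by
  have h1 : HasDerivAt (fun t => V t p.1) (-Complex.I • p.2) (s - s) := by
    rw [sub_self]
    exact hV.hasDerivAt p hp
  have h2 := (((V s).restrictScalars ℝ).hasFDerivAt.comp_hasDerivAt s (h1.comp_sub_const s s))
  refine h2.congr_of_eventuallyEq (Eventually.of_forall fun t => ?_)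
  simp only [Function.comp_apply, ContinuousLinearMap.coe_restrictScalars']
  rw [← hV.isUnitaryGroup.map_add_apply, add_sub_cancel]

theorem IsGroupOf.hasDerivAt_neg_apply {A : Submodule ℂ (E × E)} {V : ℝ → E →L[ℂ] E}
    (hV : IsGroupOf A V) {p : E × E} (hp : p ∈ A) (s : ℝ) :
    HasDerivAt (fun t => V (-t) p.1) (V (-s) (Complex.I • p.2)) s := by
  have h := (hV.hasDerivAt_apply hp (-s)).scomp s (hasDerivAt_neg s)
  simpa [Function.comp_def] using h

theorem IsGroupOf.hasDerivAt_neg_apply_comp {A : Submodule ℂ (E × E)} {V : ℝ → E →L[ℂ] E}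
    (hV : IsGroupOf A V) {u : ℝ → E} {u' b : E} {s : ℝ} (hu : HasDerivAt u u' s)
    (hb : (u s, b) ∈ A) :
    HasDerivAt (fun r => V (-r) (u r)) (V (-s) (u' + Complex.I • b)) s := by
  rw [map_add]
  exact hasDerivAt_apply_of_norm_map (A := fun r => V (-r)) (fun t => hV.isUnitaryGroup.norm_map _)
    hu (hV.hasDerivAt_neg_apply hb s)
    ((hV.isUnitaryGroup.continuous u').comp continuous_neg).continuousAt

/-- Differentiating ⟨V_s V_t x, y⟩ at s = 0, once through x and once through y, shows that V_t x
lies in the domain of h^* = h. -/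
theorem IsGroupOf.map_domain [CompleteSpace E] {h : E →ₗ.[ℂ] E} (hh : IsSelfAdjoint h)
    {V : ℝ → E →L[ℂ] E} (hV : IsGroupOf h.graph V) (t : ℝ) (x : h.domain) :
    ∃ y : h.domain, (y : E) = V t x ∧ h y = V t (h x) := by
  have hU := hV.isUnitaryGroup
  obtain ⟨hy, hy'⟩ := mem_domain_of_inner_eq hh (V t x) (V t (h x)) fun y => by
    have h1 : HasDerivAt (fun s => inner ℂ (V s (V t x)) (y : E))
        (inner ℂ (V t (-Complex.I • h x)) (y : E)) 0 := by
      have h2 := (hV.hasDerivAt_apply (h.mem_graph x) (0 + t)).comp_add_const 0 t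
      have h3 := h2.inner ℂ (hasDerivAt_const (0 : ℝ) (y : E))
      simp only [hU.map_add_apply] at h3
      simpa [hU.map_zero] using h3
    have h2 : HasDerivAt (fun s => inner ℂ (V s (V t x)) (y : E))
        (inner ℂ (V t x) (Complex.I • h y)) 0 := by
      have h2 := hV.hasDerivAt_neg_apply (h.mem_graph y) 0
      have h3 := (hasDerivAt_const (0 : ℝ) (V t x)).inner ℂ h2
      simp only [hU.inner_apply_left _ (V t x)]
      simpa [hU.map_zero, -map_smul, inner_smul_right] using h3
    have h3 := h1.unique h2
    rw [map_smul, inner_smul_left, inner_smul_right] at h3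
    simp only [map_neg, Complex.conj_I, neg_neg] at h3
    exact mul_left_cancel₀ Complex.I_ne_zero h3
  exact ⟨⟨V t x, hy⟩, rfl, hy'⟩

/-- A family of vectors with the inner products of a total family is its image under an isometry. -/
theorem exists_isometry_of_inner_eq [CompleteSpace E] {ι : Type*} (v w : ι → E)
    (hv : (Submodule.span ℂ (Set.range v)).topologicalClosure = ⊤)
    (h : ∀ i j, inner ℂ (w i) (w j) = inner ℂ (v i) (v j)) :
    ∃ U : E →L[ℂ] E, (∀ x, ‖U x‖ = ‖x‖) ∧ ∀ i, U (v i) = w i := by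
  let a : (ι →₀ ℂ) →ₗ[ℂ] E := Finsupp.linearCombination ℂ v
  let b : (ι →₀ ℂ) →ₗ[ℂ] E := Finsupp.linearCombination ℂ w
  have hdense : DenseRange a := by
    rw [DenseRange, ← LinearMap.coe_range, Finsupp.range_linearCombination,
      ← Submodule.dense_iff_topologicalClosure_eq_top] at *
    exact hv
  have hnorm : ∀ f, ‖b f‖ = ‖a f‖ := by
    intro f
    have : inner ℂ (b f) (b f) = inner ℂ (a f) (a f) := by
      simp only [a, b, Finsupp.linearCombination_apply, Finsupp.sum, sum_inner, inner_sum,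
        inner_smul_left, inner_smul_right, h]
    rw [inner_self_eq_norm_sq_to_K, inner_self_eq_norm_sq_to_K] at this
    exact (pow_left_inj₀ (norm_nonneg _) (norm_nonneg _) two_ne_zero).1 (by exact_mod_cast this)
  have hle : ∀ f, ‖b f‖ ≤ 1 * ‖a f‖ := fun f => by rw [one_mul, hnorm]
  have hU := LinearMap.extendOfNorm_eq hdense ⟨1, hle⟩
  refine ⟨b.extendOfNorm a, fun x => ?_, fun i => ?_⟩
  · refine hdense.induction_on (p := fun x => ‖b.extendOfNorm a x‖ = ‖x‖) x
      (isClosed_eq (by fun_prop) (by fun_prop)) fun f => ?_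
    rw [hU, hnorm]
  · have := hU (Finsupp.single i 1)
    simpa [a, b] using this

theorem ext_of_span_range {G ι : Type*} [NormedAddCommGroup G] [NormedSpace ℂ G] {v : ι → E}
    (hv : (Submodule.span ℂ (Set.range v)).topologicalClosure = ⊤) {A B : E →L[ℂ] G}
    (h : ∀ i, A (v i) = B (v i)) : A = B := by
  refine ContinuousLinearMap.ext_on (s := Set.range v) ?_ (by rintro _ ⟨i, rfl⟩; exact h i)
  exact Submodule.dense_iff_topologicalClosure_eq_top.2 hv

end GroupLemmas

/-! ### Product vectors of the Fock space: multilinearity, symmetry, permanents. -/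

section ProductVec

variable {F : Type*} [NormedAddCommGroup F] [InnerProductSpace ℂ F]

/-- The simple tensor as a multilinear map. -/
def simpleTensorMulti (n : ℕ) : MultilinearMap ℂ (fun _ : Fin n => F) (TensorPow F n) :=
  (UniformSpace.Completion.toComplL (𝕜 := ℂ) (E := AlgTensorPow F n)).toLinearMap.compMultilinearMap
    (PiTensorProduct.tprod ℂ : MultilinearMap ℂ (fun _ : Fin n => F) (AlgTensorPow F n))

/-- `symTensor` as a multilinear map. -/
def symTensorMulti (n : ℕ) : MultilinearMap ℂ (fun _ : Fin n => F) (TensorPow F n) :=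
  (((√(n.factorial : ℝ))⁻¹ : ℝ) : ℂ) • ∑ σ : Equiv.Perm (Fin n),
    (simpleTensorMulti n).domDomCongr σ

theorem symTensorMulti_apply {n : ℕ} (x : Fin n → F) : symTensorMulti n x = symTensor x := by
  simp only [symTensorMulti, smul_apply, sum_apply]
  rfl

/-- `productVec` as a multilinear map. -/
def productVecMulti (n : ℕ) : MultilinearMap ℂ (fun _ : Fin n => F) (Fock F) :=
  (lp.lsingle (𝕜 := ℂ) (E := fun n : ℕ => symPow F n) 2 n).compMultilinearMap
    ((symTensorMulti n).codRestrict (symPow F n) fun x => by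
      rw [symTensorMulti_apply]
      exact Submodule.le_topologicalClosure _ (Submodule.subset_span ⟨x, rfl⟩))

theorem productVecMulti_apply {n : ℕ} (x : Fin n → F) : productVecMulti n x = productVec x := by
  have : (symTensorMulti n).codRestrict (symPow F n) (fun x => by
      rw [symTensorMulti_apply]
      exact Submodule.le_topologicalClosure _ (Submodule.subset_span ⟨x, rfl⟩)) x =
      ⟨symTensor x, Submodule.le_topologicalClosure _ (Submodule.subset_span ⟨x, rfl⟩)⟩ :=
    Subtype.ext (symTensorMulti_apply x)
  simp only [productVecMulti, LinearMap.compMultilinearMap_apply, this]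
  rfl

theorem norm_productVec_le {n : ℕ} (x : Fin n → F) :
    ‖productVec x‖ ≤ √(n.factorial : ℝ) * ∏ i, ‖x i‖ := by
  rw [← pow_le_pow_iff_left₀ (norm_nonneg _) (by positivity) two_ne_zero, mul_pow,
    Real.sq_sqrt (by positivity)]
  have h1 : ((‖productVec x‖ ^ 2 : ℝ) : ℂ) = _ :=
    (by exact_mod_cast (inner_self_eq_norm_sq_to_K (𝕜 := ℂ) (productVec x)).symm :
      ((‖productVec x‖ ^ 2 : ℝ) : ℂ) = inner ℂ (productVec x) (productVec x)).trans
        (inner_productVec x x)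
  calc ‖productVec x‖ ^ 2 = ‖((‖productVec x‖ ^ 2 : ℝ) : ℂ)‖ := by
        rw [Complex.norm_real, Real.norm_of_nonneg (by positivity)]
    _ ≤ ∑ σ : Equiv.Perm (Fin n), ∏ i, (‖x i‖ * ‖x (σ i)‖) := by
        rw [h1]
        refine norm_sum_le_of_le _ fun σ _ => ?_
        rw [norm_prod]
        exact Finset.prod_le_prod (fun _ _ => norm_nonneg _) fun i _ => norm_inner_le_norm _ _
    _ = _ := by
        have : ∀ σ : Equiv.Perm (Fin n), ∏ i, (‖x i‖ * ‖x (σ i)‖) = (∏ i, ‖x i‖) ^ 2 := by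
          intro σ
          rw [Finset.prod_mul_distrib, Equiv.prod_comp σ (fun i => ‖x i‖), sq]
        simp [this, Fintype.card_perm]

/-- `productVec` as a continuous multilinear map. -/
def productVecL (n : ℕ) : ContinuousMultilinearMap ℂ (fun _ : Fin n => F) (Fock F) :=
  (productVecMulti n).mkContinuous (√(n.factorial : ℝ)) fun x => by
    rw [productVecMulti_apply]
    exact norm_productVec_le x

theorem productVecL_apply {n : ℕ} (x : Fin n → F) : productVecL n x = productVec x :=
  productVecMulti_apply x

theorem continuous_productVec {n : ℕ} : Continuous (productVec : (Fin n → F) → Fock F) := by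
  have := (productVecL (F := F) n).cont
  exact this.congr productVecL_apply

theorem hasDerivAt_productVec {n : ℕ} {u : ℝ → Fin n → F} {u' : Fin n → F} {s : ℝ}
    (hu : ∀ i, HasDerivAt (fun t => u t i) (u' i) s) :
    HasDerivAt (fun t => productVec (u t))
      (∑ i, productVec (Function.update (u s) i (u' i))) s := by
  have h1 := ((productVecL (F := F) n).restrictScalars ℝ).hasFDerivAt (u s)
  have h2 := h1.comp_hasDerivAt s (hasDerivAt_pi.2 hu)
  refine (h2.congr_deriv (ContinuousMultilinearMap.linearDeriv_apply _ _ _)).congr_deriv ?_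
    |>.congr_of_eventuallyEq ?_
  · exact Finset.sum_congr rfl fun i _ => productVecL_apply _
  · exact Eventually.of_forall fun t => (productVecL_apply _).symm

theorem hasDerivAt_productVec_complex {n : ℕ} {u : ℂ → Fin n → F} {u' : Fin n → F} {s : ℂ}
    (hu : ∀ i, HasDerivAt (fun t => u t i) (u' i) s) :
    HasDerivAt (fun t => productVec (u t))
      (∑ i, productVec (Function.update (u s) i (u' i))) s := by
  have h1 := (productVecL (F := F) n).hasFDerivAt (u s)
  have h2 := h1.comp_hasDerivAt s (hasDerivAt_pi.2 hu)
  rw [ContinuousMultilinearMap.linearDeriv_apply] at h2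
  simpa [Function.comp_def, productVecL_apply] using h2

theorem productVec_comp_perm {n : ℕ} (x : Fin n → F) (τ : Equiv.Perm (Fin n)) :
    productVec (fun i => x (τ i)) = productVec x := by
  have : symTensor (fun i => x (τ i)) = symTensor x := by
    unfold symTensor
    congr 1
    exact Fintype.sum_equiv (Equiv.mulLeft τ) _ _ fun σ => rfl
  unfold productVec
  congr 1
  exact Subtype.ext this

theorem productVec_cons_cons {n : ℕ} (a b : F) (x : Fin n → F) :
    productVec (Fin.cons a (Fin.cons b x : Fin (n + 1) → F) : Fin (n + 2) → F) =
      productVec (Fin.cons b (Fin.cons a x : Fin (n + 1) → F) : Fin (n + 2) → F) := by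
  rw [← productVec_comp_perm _ (Equiv.swap 0 1)]
  congr 1
  funext i
  refine Fin.cases ?_ (fun j => ?_) i
  · simp
  · refine Fin.cases ?_ (fun k => ?_) j
    · simp
    · have h : Equiv.swap (0 : Fin (n + 2)) 1 k.succ.succ = k.succ.succ :=
        Equiv.swap_apply_of_ne_of_ne (Fin.succ_ne_zero _)
          fun h => Fin.succ_ne_zero k (Fin.succ_injective _ h)
      rw [h]
      simp

theorem productVec_update_const {n : ℕ} (f k : F) (i : Fin (n + 1)) :
    productVec (Function.update (fun _ : Fin (n + 1) => f) i k) =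
      productVec (Fin.cons k (fun _ : Fin n => f) : Fin (n + 1) → F) := by
  rw [← productVec_comp_perm _ (Equiv.swap 0 i)]
  congr 1
  funext j
  refine Fin.cases ?_ (fun l => ?_) j
  · simp
  · rw [Fin.cons_succ, Function.update_of_ne]
    rw [Ne, Equiv.swap_apply_eq_iff, Equiv.swap_apply_right]
    exact Fin.succ_ne_zero l

/-- The expansion of a permanent along its first row. -/
theorem sum_perm_prod_cons {n : ℕ} (f : Fin (n + 1) → Fin (n + 1) → ℂ) :
    ∑ σ : Equiv.Perm (Fin (n + 1)), ∏ i, f i (σ i) =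
      ∑ j, f 0 j * ∑ τ : Equiv.Perm (Fin n), ∏ i, f i.succ (j.succAbove (τ i)) := by
  simp only [Finset.mul_sum]
  rw [← Fintype.sum_prod_type']
  symm
  -- The pair (j, τ) becomes the permutation with 0 ↦ j and i+1 ↦ j.succAbove (τ i); injectivity and
  -- (n+1)! = (n+1)·n! give bijectivity.
  let e : Fin (n + 1) × Equiv.Perm (Fin n) → Equiv.Perm (Fin (n + 1)) := fun p =>
    (Equiv.Perm.decomposeFin.symm (0, p.2)).trans p.1.cycleRange.symm
  have h0 : ∀ p, e p 0 = p.1 := fun p => by simp [e]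
  have h1 : ∀ p i, e p (Fin.succ i) = p.1.succAbove (p.2 i) := fun p i => by
    simp [e, Fin.cycleRange_symm_succ]
  have hinj : Function.Injective e := by
    rintro ⟨j, τ⟩ ⟨j', τ'⟩ h
    have h2 : j = j' := by
      have := congrArg (fun σ => σ 0) h
      simpa only [h0] using this
    subst h2
    congr 1
    ext1 i
    have := congrArg (fun σ => σ i.succ) h
    simp only [h1] at this
    exact Fin.succAbove_right_injective this
  have hbij : Function.Bijective e := by
    rw [Fintype.bijective_iff_injective_and_card]
    refine ⟨hinj, ?_⟩
    simp [Fintype.card_perm, Nat.factorial_succ]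
  refine Fintype.sum_bijective e hbij _ _ fun p => ?_
  rw [Fin.prod_univ_succ, h0]
  simp only [h1]

/-- For matching particle numbers this is the expansion of the permanent along the row of g. -/
theorem inner_creation_productVec (g : F) {n : ℕ} (x : Fin n → F) {m : ℕ} (y : Fin m → F) :
    inner ℂ (creation g x) (productVec y) = inner ℂ (productVec x) (annihilation g y) := by
  unfold creation
  cases m with
  | zero =>
    rw [inner_productVec_of_ne (Nat.succ_ne_zero n)]
    simp [annihilation]
  | succ m =>
    rw [annihilation, inner_sum]
    by_cases h : n = m
    · subst h
      rw [inner_productVec, sum_perm_prod_cons fun i j =>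
        inner ℂ ((Fin.cons g x : Fin (n + 1) → F) i) (y j)]
      simp only [inner_smul_right, inner_productVec, Fin.cons_zero, Fin.cons_succ]
    · rw [inner_productVec_of_ne (by omega)]
      symm
      refine Finset.sum_eq_zero fun i _ => ?_
      rw [inner_smul_right, inner_productVec_of_ne h, mul_zero]

theorem eq_zero_of_inner_productVec [CompleteSpace F] {Φ : Fock F}
    (h : ∀ (n : ℕ) (x : Fin n → F), inner ℂ (productVec x) Φ = 0) : Φ = 0 := by
  ext1
  funext n
  have h1 : ∀ ξ ∈ symPow F n, inner ℂ ξ ((Φ n : symPow F n) : TensorPow F n) = 0 := by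
    have h2 : symPow F n ≤ (innerSL ℂ ((Φ n : symPow F n) : TensorPow F n)).ker := by
      refine Submodule.topologicalClosure_minimal _ ?_ (ContinuousLinearMap.isClosed_ker _)
      rw [Submodule.span_le]
      rintro _ ⟨x, rfl⟩
      have h3 := h n x
      rw [productVec, lp.inner_single_left, Submodule.coe_inner] at h3
      simp only [SetLike.mem_coe, LinearMap.mem_ker]
      rw [← inner_conj_symm] at h3
      exact (map_eq_zero _).1 h3
    intro ξ hξ
    have h3 : inner ℂ ((Φ n : symPow F n) : TensorPow F n) ξ = 0 := h2 hξ
    rw [← inner_conj_symm, h3, map_zero]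
  have h2 := h1 _ (Φ n).2
  rw [inner_self_eq_zero] at h2
  exact Subtype.ext h2

end ProductVec

/-! ### System tensor bath: totality of ψ ⊗ product vectors, and the operators L ⊗ 1. -/

section Ket

variable {S F : Type*} [NormedAddCommGroup S] [InnerProductSpace ℂ S]
  [NormedAddCommGroup F] [InnerProductSpace ℂ F]

/-- The map `Φ ↦ φ ⊗ Φ`. -/
def ketRight (φ : S) : Fock F →L[ℂ] Total S F :=
  (UniformSpace.Completion.toComplL (𝕜 := ℂ) (E := AlgTotal S F)) ∘L
    (TensorProduct.mkL ℂ S (Fock F) φ : Fock F →L[ℂ] AlgTotal S F)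

theorem ketRight_apply (φ : S) (Φ : Fock F) : ketRight φ Φ = ket φ Φ := rfl

theorem ketCLM_apply (φ : S) (Φ : Fock F) : ketCLM Φ φ = ket φ Φ := rfl

theorem norm_ket (φ : S) (Φ : Fock F) : ‖ket φ Φ‖ = ‖φ‖ * ‖Φ‖ := by
  have h := inner_ket φ φ Φ Φ
  simp only [inner_self_eq_norm_sq_to_K] at h
  rw [← pow_left_inj₀ (norm_nonneg _) (by positivity) two_ne_zero, mul_pow]
  exact_mod_cast h

theorem eq_zero_of_inner_ket_productVec [CompleteSpace F] {Ξ : Total S F}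
    (h : ∀ (ψ : S) (n : ℕ) (x : Fin n → F), inner ℂ (ket ψ (productVec x)) Ξ = 0) : Ξ = 0 := by
  have h1 : ∀ (ψ : S) (Φ : Fock F), inner ℂ (ket ψ Φ) Ξ = 0 := by
    intro ψ Φ
    have h2 : (ketRight ψ).adjoint Ξ = 0 := eq_zero_of_inner_productVec fun n x => by
      rw [ContinuousLinearMap.adjoint_inner_right, ketRight_apply, h]
    rw [← ketRight_apply, ← ContinuousLinearMap.adjoint_inner_right, h2, inner_zero_right]
  have h2 : ∀ ξ : AlgTotal S F, inner ℂ (ξ : Total S F) Ξ = 0 := by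
    intro ξ
    let c : AlgTotal S F → Total S F := fun ξ => ξ
    refine TensorProduct.induction_on (motive := fun ξ : S ⊗[ℂ] Fock F =>
      inner ℂ (c ξ) Ξ = 0) ξ ?_ h1 ?_
    · exact (congrArg (inner ℂ · Ξ) (UniformSpace.Completion.coe_zero (α := AlgTotal S F))).trans
        (inner_zero_left _)
    · intro a b ha hb
      refine (congrArg (inner ℂ · Ξ)
        (UniformSpace.Completion.coe_add (α := AlgTotal S F) a b)).trans ?_
      rw [inner_add_left]
      exact (congrArg₂ (· + ·) ha hb).trans (add_zero _)
  rw [← inner_self_eq_zero (𝕜 := ℂ)]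
  refine UniformSpace.Completion.induction_on (p := fun ξ => inner ℂ ξ Ξ = 0) Ξ
    (isClosed_eq (by fun_prop) continuous_const) h2

variable (S F) in
/-- The vectors `ψ ⊗ a(x₁)* ⋯ a(xₙ)* vac`. -/
def ketFamily (p : S × Σ n : ℕ, Fin n → F) : Total S F := ket p.1 (productVec p.2.2)

theorem span_ketFamily [CompleteSpace F] :
    (Submodule.span ℂ (Set.range (ketFamily S F))).topologicalClosure = ⊤ := by
  rw [Submodule.topologicalClosure_eq_top_iff, Submodule.eq_bot_iff]
  intro Ξ hΞ
  refine eq_zero_of_inner_ket_productVec fun ψ n x => ?_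
  exact (Submodule.mem_orthogonal _ _).1 hΞ _ (Submodule.subset_span ⟨(ψ, ⟨n, x⟩), rfl⟩)

theorem ext_ket_productVec [CompleteSpace F] {G : Type*} [NormedAddCommGroup G] [NormedSpace ℂ G]
    {A B : Total S F →L[ℂ] G}
    (h : ∀ (ψ : S) (n : ℕ) (x : Fin n → F),
      A (ket ψ (productVec x)) = B (ket ψ (productVec x))) : A = B :=
  ext_of_span_range span_ketFamily fun p => h p.1 p.2.1 p.2.2

theorem continuous_ket_productVec (ψ : S) {n : ℕ} :
    Continuous fun x : Fin n → F => ket ψ (productVec x) :=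
  (ketRight ψ).continuous.comp continuous_productVec

/-- The operator `L ⊗ 1`. -/
def systemOp (L : S →L[ℂ] S) : Total S F →L[ℂ] Total S F :=
  (show AlgTotal S F →L[ℂ] AlgTotal S F from L.rTensor (Fock F)).completion

theorem systemOp_ket (L : S →L[ℂ] S) (ψ : S) (Φ : Fock F) :
    systemOp L (ket ψ Φ) = ket (L ψ) Φ :=
  UniformSpace.Completion.map_coe
    (show AlgTotal S F →L[ℂ] AlgTotal S F from L.rTensor (Fock F)).uniformContinuous _

theorem inner_systemOp_ket [CompleteSpace S] [CompleteSpace F] (L : S →L[ℂ] S) (Ξ : Total S F)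
    (ψ : S) (Φ : Fock F) :
    inner ℂ (systemOp L Ξ) (ket ψ Φ) = inner ℂ Ξ (ket (ContinuousLinearMap.adjoint L ψ) Φ) := by
  have h : (innerSL ℂ (ket ψ Φ)).comp (systemOp L) =
      innerSL ℂ (ket (ContinuousLinearMap.adjoint L ψ) Φ) := by
    refine ext_ket_productVec fun ψ' n x => ?_
    simp only [ContinuousLinearMap.comp_apply, innerSL_apply_apply, systemOp_ket, inner_ket,
      ContinuousLinearMap.adjoint_inner_left]
  have h1 := DFunLike.congr_fun h Ξ
  simp only [ContinuousLinearMap.comp_apply, innerSL_apply_apply] at h1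
  rw [← inner_conj_symm, h1, inner_conj_symm]

end Ket

/-! ### Generators and strong continuity, checked on spanning sets. -/

section Generators

variable {E : Type*} [NormedAddCommGroup E] [InnerProductSpace ℂ E]

theorem isGroupOf_unitaryGroup {A : Submodule ℂ (E × E)} (hA : ∃ V, IsGroupOf A V) :
    IsGroupOf A (unitaryGroup A) := by
  rw [unitaryGroup, dif_pos hA]
  exact hA.choose_spec

theorem IsUnitaryGroup.isGroupOf_span {V : ℝ → E →L[ℂ] E} (hV : IsUnitaryGroup V) {s : Set (E × E)}
    (hs : ∀ p ∈ s, HasDerivAt (fun t => V t p.1) (-Complex.I • p.2) 0) :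
    IsGroupOf (Submodule.span ℂ s) V := by
  refine ⟨hV, fun p hp => ?_⟩
  induction hp using Submodule.span_induction with
  | mem p hp => exact hs p hp
  | zero => simpa using hasDerivAt_const (0 : ℝ) (0 : E)
  | add p q _ _ hp hq => simpa [smul_add] using hp.fun_add hq
  | smul c p _ hp => simpa [smul_comm c] using hp.fun_const_smul c

theorem continuous_apply_of_span_range {ι : Type*} {v : ι → E}
    (hv : (Submodule.span ℂ (Set.range v)).topologicalClosure = ⊤) {A : ℝ → E →L[ℂ] E}
    (hA : ∀ t x, ‖A t x‖ = ‖x‖) (hc : ∀ i, Continuous fun t => A t (v i)) (x : E) :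
    Continuous fun t => A t x := by
  have h1 : ∀ y ∈ Submodule.span ℂ (Set.range v), Continuous fun t => A t y := by
    intro y hy
    induction hy using Submodule.span_induction with
    | mem y hy =>
      obtain ⟨i, rfl⟩ := hy
      exact hc i
    | zero => simpa using continuous_const
    | add y z _ _ hy hz => simpa using hy.fun_add hz
    | smul c y _ hy => simpa using hy.fun_const_smul c
  refine continuous_of_uniform_approx_of_continuous fun w hw => ?_
  obtain ⟨ε, hε, hw⟩ := Metric.mem_uniformity_dist.1 hw
  obtain ⟨y, hy, hxy⟩ := (Submodule.dense_iff_topologicalClosure_eq_top.2 hv).exists_dist_lt x hε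
  refine ⟨_, h1 y hy, fun t => hw ?_⟩
  rw [dist_eq_norm, ← map_sub, hA, ← dist_eq_norm]
  exact hxy

end Generators

/-! ### The free evolution as second quantization of the one-particle group. -/

section FreeGroup

variable {S F : Type*} [NormedAddCommGroup S] [InnerProductSpace ℂ S]
  [NormedAddCommGroup F] [InnerProductSpace ℂ F]

theorem productVec_update_smul {n : ℕ} (x : Fin n → F) (i : Fin n) (c : ℂ) (y : F) :
    productVec (Function.update x i (c • y)) = c • productVec (Function.update x i y) := by
  simp only [← productVecMulti_apply, MultilinearMap.map_update_smul]

theorem hasDerivAt_ket {Φ : ℝ → Fock F} {Φ' : Fock F} {s : ℝ} (ψ : S) (h : HasDerivAt Φ Φ' s) :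
    HasDerivAt (fun t => ket ψ (Φ t)) (ket ψ Φ') s :=
  ((ketRight (S := S) (F := F) ψ).restrictScalars ℝ).hasFDerivAt.comp_hasDerivAt s h

theorem hasDerivAt_ket_productVec {h : F →ₗ.[ℂ] F} {u : ℝ → F →L[ℂ] F}
    (hu : IsGroupOf h.graph u) (ψ : S) {n : ℕ} (x : Fin n → h.domain) :
    HasDerivAt (fun t => ket ψ (productVec fun i => u t (x i)))
      (-Complex.I • ket ψ (secondQuant h x)) 0 := by
  have h1 := hasDerivAt_ket ψ (hasDerivAt_productVec (u := fun t i => u t (x i))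
    fun i => hu.hasDerivAt _ (h.mem_graph (x i)))
  refine h1.congr_deriv ?_
  simp only [productVec_update_smul, hu.isUnitaryGroup.map_zero, one_apply_eq_self,
    ← Finset.smul_sum, ← ketRight_apply, map_smul, secondQuant]

/-- Isometries of the one-particle space preserve all permanents of inner products, hence the Gram
matrix of the total family of product vectors. -/
theorem exists_secondQuantGroup [CompleteSpace F] {u : ℝ → F →L[ℂ] F} (hu : IsUnitaryGroup u) :
    ∃ W : ℝ → Total S F →L[ℂ] Total S F, IsUnitaryGroup W ∧
      ∀ t (ψ : S) (n : ℕ) (x : Fin n → F),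
        W t (ket ψ (productVec x)) = ket ψ (productVec fun i => u t (x i)) := by
  have h1 : ∀ t, ∃ U : Total S F →L[ℂ] Total S F, (∀ x, ‖U x‖ = ‖x‖) ∧
      ∀ p : S × Σ n : ℕ, Fin n → F, U (ketFamily S F p) =
        ket p.1 (productVec fun i => u t (p.2.2 i)) := by
    intro t
    refine exists_isometry_of_inner_eq _ _ span_ketFamily ?_
    rintro ⟨ψ, n, x⟩ ⟨ψ', m, y⟩
    simp only [ketFamily, inner_ket]
    congr 1
    by_cases h : n = m
    · subst h
      simp only [inner_productVec, inner_map_map_of_norm_map (hu.norm_map t)]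
    · rw [inner_productVec_of_ne h, inner_productVec_of_ne h]
  choose W hn hW using h1
  have hW' : ∀ t (ψ : S) (n : ℕ) (x : Fin n → F),
      W t (ket ψ (productVec x)) = ket ψ (productVec fun i => u t (x i)) :=
    fun t ψ n x => hW t (ψ, ⟨n, x⟩)
  refine ⟨W, ⟨?_, fun s t => ?_, hn, ?_⟩, hW'⟩
  · refine ext_ket_productVec fun ψ n x => ?_
    rw [hW', hu.map_zero]
    rfl
  · refine ext_ket_productVec fun ψ n x => ?_
    simp only [ContinuousLinearMap.comp_apply, hW', hu.map_add_apply]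
  · refine continuous_apply_of_span_range span_ketFamily hn ?_
    rintro ⟨ψ, n, x⟩
    simp only [ketFamily, hW']
    exact (continuous_ket_productVec ψ).comp (continuous_pi fun i => hu.continuous _)

theorem isGroupOf_freeHamiltonian {h : F →ₗ.[ℂ] F} {u : ℝ → F →L[ℂ] F}
    (hu : IsGroupOf h.graph u) {W : ℝ → Total S F →L[ℂ] Total S F} (hW : IsUnitaryGroup W)
    (hWu : ∀ t (ψ : S) (n : ℕ) (x : Fin n → F),
        W t (ket ψ (productVec x)) = ket ψ (productVec fun i => u t (x i))) :
    IsGroupOf (freeHamiltonian S h) W := by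
  refine hW.isGroupOf_span ?_
  rintro _ ⟨ψ, n, x, rfl⟩
  simp only [hWu]
  exact hasDerivAt_ket_productVec hu ψ x

theorem denseRange_pi_domain {h : F →ₗ.[ℂ] F} (hd : Dense (h.domain : Set F)) (n : ℕ) :
    DenseRange fun (x : Fin n → h.domain) (i : Fin n) => (x i : F) :=
  DenseRange.piMap (f := fun (_ : Fin n) (y : h.domain) => (y : F)) fun _ => by
    simpa [DenseRange] using hd

/-- The domain of the free Hamiltonian consists of spans of product vectors, so its invariance and
the commutation of the group with dΓ(h) are inherited factor by factor from `IsGroupOf.map_domain`.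
-/
theorem exists_domain_eq_group_apply [CompleteSpace F] {h : F →ₗ.[ℂ] F} (hh : IsSelfAdjoint h)
    {u : ℝ → F →L[ℂ] F} (hu : IsGroupOf h.graph u) {W : ℝ → Total S F →L[ℂ] Total S F}
    (hWu : ∀ t (ψ : S) (n : ℕ) (x : Fin n → F),
        W t (ket ψ (productVec x)) = ket ψ (productVec fun i => u t (x i)))
    (t : ℝ) (ψ : S) {n : ℕ} (x : Fin n → h.domain) :
    ∃ y : Fin n → h.domain, (∀ i, (y i : F) = u t (x i)) ∧
      ket ψ (secondQuant h y) = W t (ket ψ (secondQuant h x)) := by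
  choose y hy hy' using fun i => hu.map_domain hh t (x i)
  refine ⟨y, hy, ?_⟩
  simp only [← ketRight_apply, secondQuant, map_sum]
  refine Finset.sum_congr rfl fun i _ => ?_
  rw [ketRight_apply, ketRight_apply, hWu]
  congr 2
  funext j
  by_cases hj : j = i
  · subst hj
    simp [hy']
  · simp [hj, hy]

/-- The unitary group of the free Hamiltonian is the second quantization of the one-particle group. -/
theorem unitaryGroup_freeHamiltonian [CompleteSpace F] {h : F →ₗ.[ℂ] F} (hh : IsSelfAdjoint h) :
    IsGroupOf (freeHamiltonian S h) (unitaryGroup (freeHamiltonian S h)) ∧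
    ∀ t (ψ : S) (n : ℕ) (x : Fin n → F),
      unitaryGroup (freeHamiltonian S h) t (ket ψ (productVec x)) =
        ket ψ (productVec fun i => unitaryGroup h.graph t (x i)) := by
  have hu := isGroupOf_unitaryGroup (exists_isGroupOf_graph hh)
  set u := unitaryGroup h.graph
  obtain ⟨W, hW, hWu⟩ := exists_secondQuantGroup (S := S) hu.isUnitaryGroup
  have hWA := isGroupOf_freeHamiltonian hu hW hWu
  have hV := isGroupOf_unitaryGroup ⟨W, hWA⟩
  refine ⟨hV, fun t ψ n x => ?_⟩
  set V := unitaryGroup (freeHamiltonian S h)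
  rw [← hWu]
  -- The group V is an arbitrary choice with the right generator. For factors in the domain of h,
  -- V_{-r} W_r v has zero derivative in r, which forces V = W; density does the rest.
  refine (denseRange_pi_domain hh.dense_domain n).induction_on
    (p := fun x => V t (ket ψ (productVec x)) = W t (ket ψ (productVec x))) x ?_ fun x => ?_
  · exact isClosed_eq ((V t).continuous.comp (continuous_ket_productVec ψ))
      ((W t).continuous.comp (continuous_ket_productVec ψ))
  · set v := ket ψ (productVec fun i => (x i : F)) with hv
    have hp : (v, ket ψ (secondQuant h x)) ∈ freeHamiltonian S h :=
      Submodule.subset_span ⟨ψ, n, x, rfl⟩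
    have h1 : ∀ s, HasDerivAt (fun r => V (-r) (W r v)) 0 s := by
      intro s
      obtain ⟨y, hy, hy'⟩ := exists_domain_eq_group_apply hh hu hWu s ψ x
      have h3 : (W s v, W s (ket ψ (secondQuant h x))) ∈ freeHamiltonian S h := by
        refine Submodule.subset_span ⟨ψ, n, y, ?_⟩
        rw [hy', hv, hWu]
        simp only [hy]
      have h2 := hV.hasDerivAt_neg_apply_comp (hWA.hasDerivAt_apply hp s) h3
      simpa using h2
    have h2 := is_const_of_deriv_eq_zero (fun s => (h1 s).differentiableAt)
      (fun s => (h1 s).deriv) t 0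
    simp only [neg_zero, hV.isUnitaryGroup.map_zero, hW.map_zero, one_apply_eq_self] at h2
    rw [← hV.isUnitaryGroup.apply_neg_apply t (W t v), h2]

end FreeGroup

/-! ### A factorial series and an integral inequality. -/

section Estimates

/-- From (b+N)! ≤ b! N! 2^{b+N} the square of each term is at most A_N 2^{-N}, with A_N a term of an
exponential series; hence the term is at most A_N + 2^{-N}. -/
theorem summable_pow_mul_sqrt_factorial (a : ℝ) (ha : 0 ≤ a) (b : ℕ) :
    Summable fun N : ℕ => a ^ N / N.factorial * √((b + N).factorial : ℝ) := by
  have h1 : Summable fun N : ℕ => ((b.factorial : ℝ) * 2 ^ b) * ((4 * a ^ 2) ^ N / (N.factorial : ℝ)) :=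
    (Real.summable_pow_div_factorial _).mul_left _
  have h2 : Summable fun N : ℕ => (1 / 2 : ℝ) ^ N := summable_geometric_two
  refine Summable.of_nonneg_of_le (fun N => by positivity) (fun N => ?_) (h1.add h2)
  have hN : (0 : ℝ) < N.factorial := by positivity
  have h3 : ((b + N).factorial : ℝ) ≤ b.factorial * N.factorial * 2 ^ (b + N) := by
    have := Nat.add_choose_mul_factorial_mul_factorial b N
    have h4 : (b + N).choose N ≤ 2 ^ (b + N) := Nat.choose_le_two_pow _ _
    have h5 : (b + N).factorial ≤ b.factorial * N.factorial * 2 ^ (b + N) := by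
      rw [← this]
      calc _ = b.factorial * N.factorial * (b + N).choose N := by ring
        _ ≤ _ := by gcongr
    exact_mod_cast h5
  set s := a ^ N / N.factorial * √((b + N).factorial : ℝ) with hs
  set A := ((b.factorial : ℝ) * 2 ^ b) * ((4 * a ^ 2) ^ N / (N.factorial : ℝ)) with hA
  have hA0 : 0 ≤ A := by positivity
  have hs0 : 0 ≤ s := by positivity
  have hsq : s ^ 2 ≤ A * (1 / 2 : ℝ) ^ N := by
    rw [hs, mul_pow, Real.sq_sqrt (by positivity)]
    calc _ ≤ (a ^ N / N.factorial) ^ 2 * (b.factorial * N.factorial * 2 ^ (b + N)) := by gcongr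
      _ = A * (1 / 2 : ℝ) ^ N := by
        have : (4 : ℝ) ^ N = 2 ^ N * 2 ^ N := by rw [← mul_pow]; norm_num
        rw [hA, mul_pow, this, pow_add, one_div, inv_pow]
        field_simp
        ring
  have hg : (0 : ℝ) ≤ (1 / 2 : ℝ) ^ N := by positivity
  nlinarith [sq_nonneg (A - (1 / 2 : ℝ) ^ N)]

variable {E : Type*} [NormedAddCommGroup E] [NormedSpace ℝ E]

theorem norm_le_of_hasDerivAt_of_nonneg {f f' : ℝ → E} {M t : ℝ} {N : ℕ} (ht : 0 ≤ t) (hf0 : f 0 = 0)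
    (hf : ∀ s, HasDerivAt f (f' s) s) (hM : ∀ s, 0 ≤ s → s ≤ t → ‖f' s‖ ≤ M * s ^ N) :
    ‖f t‖ ≤ M * (t ^ (N + 1) / (N + 1)) := by
  refine image_norm_le_of_norm_deriv_right_le_deriv_boundary (f := f) (f' := f') (a := 0) (b := t)
    (B := fun s => M * (s ^ (N + 1) / (N + 1))) (B' := fun s => M * s ^ N)
    (fun s _ => (hf s).continuousAt.continuousWithinAt) (fun s _ => (hf s).hasDerivWithinAt)
    (by simp [hf0]) (fun s => ?_) (fun s hs => hM s hs.1 hs.2.le) ⟨ht, le_rfl⟩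
  have h1 := ((hasDerivAt_pow (N + 1) s).div_const ((N : ℝ) + 1)).const_mul M
  refine h1.congr_deriv ?_
  have : (N : ℝ) + 1 ≠ 0 := by positivity
  rw [Nat.add_sub_cancel]
  push_cast
  field_simp

theorem norm_le_of_hasDerivAt {f f' : ℝ → E} {M t : ℝ} {N : ℕ} (hf0 : f 0 = 0)
    (hf : ∀ s, HasDerivAt f (f' s) s) (hM : ∀ s, |s| ≤ |t| → ‖f' s‖ ≤ M * |s| ^ N) :
    ‖f t‖ ≤ M * (|t| ^ (N + 1) / (N + 1)) := by
  rcases le_total 0 t with ht | ht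
  · rw [abs_of_nonneg ht] at hM ⊢
    refine norm_le_of_hasDerivAt_of_nonneg ht hf0 hf fun s hs hst => ?_
    simpa [abs_of_nonneg hs] using hM s (by rwa [abs_of_nonneg hs])
  · rw [abs_of_nonpos ht] at hM ⊢
    have h1 := norm_le_of_hasDerivAt_of_nonneg (f := fun s => f (-s)) (f' := fun s => -f' (-s))
      (M := M) (N := N) (t := -t) (by linarith) (by simpa using hf0)
      (fun s => by simpa [Function.comp_def] using (hf (-s)).scomp s (hasDerivAt_neg s))
      (fun s hs hst => by
        rw [norm_neg]
        simpa [abs_of_nonneg hs] using hM (-s) (by rwa [abs_neg, abs_of_nonneg hs]))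
    simpa using h1

end Estimates

/-! ### Weighted bounds for functions of product vectors. -/

section ProductBound

variable {S F E : Type*} [NormedAddCommGroup S] [InnerProductSpace ℂ S]
  [NormedAddCommGroup F] [InnerProductSpace ℂ F] [NormedAddCommGroup E] [NormedSpace ℂ E]

/-- Contraction of the arguments of a family of functions with a vector. -/
def contract (γ : F) (Y : (n : ℕ) → (Fin n → F) → E) : (n : ℕ) → (Fin n → F) → E
  | 0, _ => 0
  | n + 1, x => ∑ i, inner ℂ γ (x i) • Y n (fun j => x (i.succAbove j))

/-- A bound for a function of the product vectors `ψ ⊗ a(x₁)* ⋯ a(xₙ)* vac`. -/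
def ProductBound (K : ℝ) (p : ℕ) (Z : S → (n : ℕ) → (Fin n → F) → E) : Prop :=
  ∀ ψ n x, ‖Z ψ n x‖ ≤ K * √((n + p).factorial : ℝ) * (‖ψ‖ * ∏ i, ‖x i‖)

variable (S F) in
/-- The product vectors `ψ ⊗ a(x₁)* ⋯ a(xₙ)* vac`. -/
def productKet (ψ : S) (n : ℕ) (x : Fin n → F) : Total S F := ket ψ (productVec x)

theorem productBound_productKet : ProductBound 1 0 (productKet S F) := by
  intro ψ n x
  rw [productKet, norm_ket, one_mul, add_zero]
  have := norm_productVec_le x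
  calc _ ≤ ‖ψ‖ * (√(n.factorial : ℝ) * ∏ i, ‖x i‖) := by gcongr
    _ = _ := by ring

/-- Removing one of n+1 arguments produces n+1 terms, and (n+1)√((n+p)!) ≤ √((n+p+2)!). -/
theorem norm_contract_le {K : ℝ} (hK : 0 ≤ K) {p : ℕ} {Y : (n : ℕ) → (Fin n → F) → E} {c : ℝ}
    (hc : 0 ≤ c) (hY : ∀ n x, ‖Y n x‖ ≤ K * √((n + p).factorial : ℝ) * (c * ∏ i, ‖x i‖)) (γ : F)
    (n : ℕ) (x : Fin n → F) :
    ‖contract γ Y n x‖ ≤ K * √((n + (p + 1)).factorial : ℝ) * (‖γ‖ * c * ∏ i, ‖x i‖) := by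
  cases n with
  | zero =>
    rw [contract, norm_zero]
    positivity
  | succ n =>
    have h1 : ((n : ℝ) + 1) * √((n + p).factorial : ℝ) ≤ √((n + 1 + (p + 1)).factorial : ℝ) := by
      refine Real.le_sqrt_of_sq_le ?_
      rw [mul_pow, Real.sq_sqrt (by positivity)]
      have : (n + 1 + (p + 1)).factorial = (n + p + 2) * ((n + p + 1) * (n + p).factorial) := by
        rw [show n + 1 + (p + 1) = (n + p) + 1 + 1 by ring, Nat.factorial_succ, Nat.factorial_succ]
      rw [this]
      push_cast
      rw [← mul_assoc]
      gcongr
      rw [sq]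
      have : (0 : ℝ) ≤ p := by positivity
      have : (0 : ℝ) ≤ n := by positivity
      gcongr <;> linarith
    rw [contract]
    calc _ ≤ ∑ i : Fin (n + 1), K * √((n + p).factorial : ℝ) * (‖γ‖ * c * ∏ i, ‖x i‖) := by
          refine norm_sum_le_of_le _ fun i _ => ?_
          rw [norm_smul]
          calc _ ≤ (‖γ‖ * ‖x i‖) * (K * √((n + p).factorial : ℝ) *
                (c * ∏ j, ‖x (i.succAbove j)‖)) := by
                gcongr
                · exact norm_inner_le_norm _ _
                · exact hY _ _
            _ = _ := by
                rw [Fin.prod_univ_succAbove _ i]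
                ring
      _ = K * (((n : ℝ) + 1) * √((n + p).factorial : ℝ)) * (‖γ‖ * c * ∏ i, ‖x i‖) := by
          simp only [Finset.sum_const, Finset.card_univ, Fintype.card_fin, nsmul_eq_mul]
          push_cast
          ring
      _ ≤ _ := by gcongr

theorem contract_map {E' : Type*} [NormedAddCommGroup E'] [NormedSpace ℂ E'] (A : E →ₗ[ℂ] E')
    (γ : F) (Y : (n : ℕ) → (Fin n → F) → E) (n : ℕ) (x : Fin n → F) :
    contract γ (fun m y => A (Y m y)) n x = A (contract γ Y n x) := by
  cases n with
  | zero => simp [contract]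
  | succ n => simp [contract]

theorem contract_sub (γ : F) (Y Y' : (n : ℕ) → (Fin n → F) → E) (n : ℕ) (x : Fin n → F) :
    contract γ (fun m y => Y m y - Y' m y) n x = contract γ Y n x - contract γ Y' n x := by
  cases n with
  | zero => simp [contract]
  | succ n => simp [contract, smul_sub]

theorem contract_productKet (γ : F) (ψ : S) (n : ℕ) (x : Fin n → F) :
    contract γ (productKet S F ψ) n x = ket ψ (annihilation γ x) := by
  rw [← ketRight_apply]
  cases n with
  | zero => simp [contract, annihilation]
  | succ n => simp [contract, annihilation, productKet, ← ketRight_apply]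

theorem continuous_contract {X : Type*} [TopologicalSpace X] {Y : X → (n : ℕ) → (Fin n → F) → E}
    (hY : ∀ n, Continuous fun p : X × (Fin n → F) => Y p.1 n p.2) {γ : X → F} (hγ : Continuous γ)
    (n : ℕ) : Continuous fun p : X × (Fin n → F) => contract (γ p.1) (Y p.1) n p.2 := by
  cases n with
  | zero => exact continuous_const
  | succ n =>
    simp only [contract]
    refine continuous_finsetSum _ fun i _ => Continuous.smul (by fun_prop) ?_
    exact (hY n).comp (by fun_prop : Continuous fun p : X × (Fin (n + 1) → F) =>
      (p.1, fun j => p.2 (i.succAbove j)))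

end ProductBound

/-! ### The interaction acting on the argument of Z, and uniqueness for its equation. -/

section Interaction

variable {S F E : Type*} [NormedAddCommGroup S] [InnerProductSpace ℂ S] [CompleteSpace S]
  [NormedAddCommGroup F] [InnerProductSpace ℂ F] [NormedAddCommGroup E] [NormedSpace ℂ E]

/-- `Z ↦ Z ∘ (iH - L ⊗ a(γ)* + L* ⊗ a(γ))` for a function `Z` of the product vectors
`ψ ⊗ a(x₁)* ⋯ a(xₙ)* vac`. -/
def interaction (H L : S →L[ℂ] S) (γ : F) (Z : S → (n : ℕ) → (Fin n → F) → E) (ψ : S) (n : ℕ)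
    (x : Fin n → F) : E :=
  Complex.I • Z (H ψ) n x - Z (L ψ) (n + 1) (Fin.cons γ x) +
    contract γ (Z (ContinuousLinearMap.adjoint L ψ)) n x

/-- Raising p by one pays for the particle that is created and for the sum over the particle that is
annihilated. -/
theorem ProductBound.interaction (H L : S →L[ℂ] S) {K G : ℝ} (hK : 0 ≤ K) {p : ℕ} {γ : F}
    (hγ : ‖γ‖ ≤ G) {Z : S → (n : ℕ) → (Fin n → F) → E} (hZ : ProductBound K p Z) :
    ProductBound (K * (‖H‖ + 2 * (‖L‖ * G))) (p + 1) (interaction H L γ Z) := by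
  intro ψ n x
  have hG : 0 ≤ G := (norm_nonneg _).trans hγ
  set w := √((n + (p + 1)).factorial : ℝ)
  set P := ∏ i, ‖x i‖
  have hP : 0 ≤ P := Finset.prod_nonneg fun _ _ => norm_nonneg _
  have hw : √((n + p).factorial : ℝ) ≤ w := by
    apply Real.sqrt_le_sqrt
    exact_mod_cast Nat.factorial_le (by omega)
  have h1 : ‖Complex.I • Z (H ψ) n x‖ ≤ K * w * (‖H‖ * ‖ψ‖ * P) := by
    rw [norm_smul, Complex.norm_I, one_mul]
    refine (hZ _ _ _).trans ?_
    have := H.le_opNorm ψ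
    gcongr
  have h2 : ‖Z (L ψ) (n + 1) (Fin.cons γ x)‖ ≤ K * w * (‖L‖ * G * ‖ψ‖ * P) := by
    refine (hZ _ _ _).trans ?_
    have := L.le_opNorm ψ
    rw [Fin.prod_univ_succ]
    simp only [Fin.cons_zero, Fin.cons_succ]
    rw [show n + 1 + p = n + (p + 1) by ring]
    calc _ ≤ K * w * (‖L‖ * ‖ψ‖ * (G * P)) := by gcongr
      _ = _ := by ring
  have h3 : ‖contract γ (Z (ContinuousLinearMap.adjoint L ψ)) n x‖ ≤
      K * w * (‖L‖ * G * ‖ψ‖ * P) := by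
    refine (norm_contract_le hK (norm_nonneg _) (hZ _) γ n x).trans ?_
    have : ‖ContinuousLinearMap.adjoint L ψ‖ ≤ ‖L‖ * ‖ψ‖ := by
      have := (ContinuousLinearMap.adjoint L).le_opNorm ψ
      rwa [LinearIsometryEquiv.norm_map] at this
    calc _ ≤ K * w * (G * (‖L‖ * ‖ψ‖) * P) := by gcongr
      _ = _ := by ring
  calc _ ≤ _ := norm_add_le_of_le ((norm_sub_le _ _).trans (add_le_add h1 h2)) h3
    _ = _ := by ring

theorem interaction_map {E' : Type*} [NormedAddCommGroup E'] [NormedSpace ℂ E'] (A : E →ₗ[ℂ] E')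
    (H L : S →L[ℂ] S) (γ : F) (Z : S → (n : ℕ) → (Fin n → F) → E) (ψ : S) (n : ℕ) (x : Fin n → F) :
    interaction H L γ (fun ψ n x => A (Z ψ n x)) ψ n x = A (interaction H L γ Z ψ n x) := by
  simp only [interaction, contract_map, map_add, map_sub, map_smul]

theorem interaction_sub (H L : S →L[ℂ] S) (γ : F) (Z Z' : S → (n : ℕ) → (Fin n → F) → E) (ψ : S)
    (n : ℕ) (x : Fin n → F) :
    interaction H L γ (fun ψ n x => Z ψ n x - Z' ψ n x) ψ n x =
      interaction H L γ Z ψ n x - interaction H L γ Z' ψ n x := by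
  simp only [interaction, contract_sub, smul_sub]
  abel

/-- Rotating every factor by u amounts to rotating the coupling vector γ, because inner products
with γ are preserved. This turns the fixed g into the moving γ_s. -/
theorem interaction_comp_isometry (H L : S →L[ℂ] S) (γ : F) {u : F →L[ℂ] F}
    (hu : ∀ x, ‖u x‖ = ‖x‖) (Z : S → (n : ℕ) → (Fin n → F) → E) (ψ : S) (n : ℕ) (x : Fin n → F) :
    interaction H L γ (fun ψ n x => Z ψ n fun i => u (x i)) ψ n x =
      interaction H L (u γ) Z ψ n fun i => u (x i) := by
  have h1 : (fun i => u ((Fin.cons γ x : Fin (n + 1) → F) i)) =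
      (Fin.cons (u γ) (fun i => u (x i)) : Fin (n + 1) → F) := by
    funext i
    refine Fin.cases ?_ (fun j => ?_) i <;> simp
  simp only [interaction, h1]
  congr 1
  cases n with
  | zero => simp [contract]
  | succ n => simp only [contract, inner_map_map_of_norm_map hu]

theorem interaction_productKet (H L : S →L[ℂ] S) (γ : F) (ψ : S) (n : ℕ) (x : Fin n → F) :
    interaction H L γ (productKet S F) ψ n x =
      Complex.I • (ket (H ψ) (productVec x) + Complex.I • ket (L ψ) (creation γ x) -
        Complex.I • ket (ContinuousLinearMap.adjoint L ψ) (annihilation γ x)) := by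
  rw [interaction, contract_productKet, smul_sub, smul_add, smul_smul, smul_smul, Complex.I_mul_I]
  simp only [productKet, creation]
  module

theorem continuous_interaction {X : Type*} [TopologicalSpace X] (H L : S →L[ℂ] S)
    {Z : X → S → (n : ℕ) → (Fin n → F) → E}
    (hZ : ∀ ψ n, Continuous fun p : X × (Fin n → F) => Z p.1 ψ n p.2) {γ : X → F}
    (hγ : Continuous γ) (ψ : S) (n : ℕ) :
    Continuous fun p : X × (Fin n → F) => interaction H L (γ p.1) (Z p.1) ψ n p.2 := by
  unfold interaction
  refine (((hZ _ _).const_smul _).sub ?_).add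
    (continuous_contract (Y := fun q => Z q (ContinuousLinearMap.adjoint L ψ)) (hZ _) hγ n)
  exact (hZ _ (n + 1)).comp (g := fun p : X × (Fin (n + 1) → F) => Z p.1 (L ψ) (n + 1) p.2)
    (f := fun p : X × (Fin n → F) => (p.1, (Fin.cons (γ p.1) p.2 : Fin (n + 1) → F)))
    (continuous_fst.prodMk
      (Continuous.finCons (hγ.comp continuous_fst) continuous_snd))

/-- The solution of `Z' = Z ∘ (iH - L ⊗ a(γ)* + L* ⊗ a(γ))` on the product vectors is unique. -/
theorem eq_zero_of_hasDerivAt_interaction (H L : S →L[ℂ] S) {γ : ℝ → F} {G : ℝ}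
    (hγ : ∀ t, ‖γ t‖ ≤ G) {Z : ℝ → S → (n : ℕ) → (Fin n → F) → E} {p : ℕ}
    (hb : ∀ T, ∃ K, 0 ≤ K ∧ ∀ t, |t| ≤ T → ProductBound K p (Z t))
    (h0 : ∀ ψ n x, Z 0 ψ n x = 0)
    (hd : ∀ t ψ n x, HasDerivAt (fun s => Z s ψ n x) (interaction H L (γ t) (Z t) ψ n x) t)
    (t : ℝ) (ψ : S) (n : ℕ) (x : Fin n → F) : Z t ψ n x = 0 := by
  obtain ⟨K, hK, hb⟩ := hb |t|
  have hG : 0 ≤ G := (norm_nonneg _).trans (hγ 0)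
  set C := ‖H‖ + 2 * (‖L‖ * G) with hC
  have hC0 : 0 ≤ C := by positivity
  -- Inserting the bound of order N into the equation and integrating from 0 gains C|s|/(N+1) and
  -- moves the weight from p+N to p+N+1. Letting N tend to infinity then gives zero.
  have h1 : ∀ N : ℕ, ∀ s, |s| ≤ |t| → ProductBound (K * C ^ N * (|s| ^ N / N.factorial)) (p + N) (Z s) := by
    intro N
    induction N with
    | zero => simpa using hb
    | succ N ih =>
      intro s hs ψ n x
      have h2 := norm_le_of_hasDerivAt (t := s) (N := N) (h0 ψ n x) (fun r => hd r ψ n x)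
        (M := K * C ^ N / N.factorial * C * √((n + (p + N + 1)).factorial : ℝ) *
          (‖ψ‖ * ∏ i, ‖x i‖)) fun r hr => by
        refine ((ih r (hr.trans hs)).interaction H L (by positivity) (hγ r) ψ n x).trans
          (le_of_eq ?_)
        rw [← hC]
        ring
      refine h2.trans (le_of_eq ?_)
      rw [Nat.factorial_succ, ← add_assoc p N 1, pow_succ C]
      push_cast
      field_simp
  have h2 : Tendsto (fun N : ℕ => K * (‖ψ‖ * ∏ i, ‖x i‖) *
      ((C * |t|) ^ N / N.factorial * √((n + p + N).factorial : ℝ))) atTop (𝓝 0) := by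
    have := (summable_pow_mul_sqrt_factorial (C * |t|) (by positivity) (n + p)).tendsto_atTop_zero
    simpa using this.const_mul (K * (‖ψ‖ * ∏ i, ‖x i‖))
  refine norm_le_zero_iff.1 (ge_of_tendsto' h2 fun N => (h1 N t le_rfl ψ n x).trans (le_of_eq ?_))
  rw [mul_pow, ← add_assoc]
  ring

end Interaction

/-! ### Equation of motion in the interaction picture and Duhamel's formula. -/

section InteractionPicture

theorem continuous_apply_of_norm_map {E : Type*} [NormedAddCommGroup E] [InnerProductSpace ℂ E]
    {A : ℝ → E →L[ℂ] E} (hA : ∀ t x, ‖A t x‖ = ‖x‖) (hc : ∀ x, Continuous fun t => A t x) :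
    Continuous fun p : ℝ × E => A p.1 p.2 := by
  rw [continuous_iff_continuousAt]
  rintro ⟨s, x⟩
  rw [ContinuousAt, tendsto_iff_norm_sub_tendsto_zero]
  have h1 : Tendsto (fun p : ℝ × E => ‖p.2 - x‖ + ‖A p.1 x - A s x‖) (𝓝 (s, x))
      (𝓝 (‖x - x‖ + ‖A s x - A s x‖)) := by
    have h2 := hc x
    exact Continuous.tendsto (by fun_prop) (s, x)
  rw [sub_self, sub_self, norm_zero, add_zero] at h1
  refine squeeze_zero (fun _ => norm_nonneg _) (fun p => ?_) h1
  calc _ = ‖A p.1 (p.2 - x) + (A p.1 x - A s x)‖ := by simp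
    _ ≤ _ := (norm_add_le _ _).trans (by rw [hA])

/-- A derivative formula on a dense set of parameters extends to all parameters. -/
theorem hasDerivAt_of_denseRange {X ι E : Type*} [TopologicalSpace X] [NormedAddCommGroup E]
    [NormedSpace ℝ E] {e : ι → X} (he : DenseRange e) {f f' : X → ℝ → E}
    (hf : ∀ s, Continuous fun x => f x s) (hf' : Continuous fun p : X × ℝ => f' p.1 p.2)
    (hd : ∀ i s, HasDerivAt (f (e i)) (f' (e i) s) s) (x : X) (s : ℝ) :
    HasDerivAt (f x) (f' x s) s := by
  have hne : NeBot (comap e (𝓝 x)) := comap_neBot fun t ht => by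
    obtain ⟨_, h, i, rfl⟩ := mem_closure_iff_nhds.1 (he x) t ht
    exact ⟨i, h⟩
  -- The filter pulled back along e approximates x by parameters with a known derivative; joint
  -- continuity of f' makes the derivatives converge locally uniformly in time.
  refine hasDerivAt_of_tendstoLocallyUniformlyOn (l := comap e (𝓝 x)) (s := Set.univ)
    (f := fun i => f (e i)) (f' := fun i => f' (e i)) (g := f x) (g' := f' x) isOpen_univ ?_
    (Eventually.of_forall fun i r _ => hd i r)
    (fun r _ => ((hf r).tendsto x).comp tendsto_comap) (Set.mem_univ s)
  rw [Metric.tendstoLocallyUniformlyOn_iff]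
  intro ε hε r _
  have h1 := Metric.continuousAt_iff'.1 (hf'.continuousAt (x := (x, r))) (ε / 2) (by positivity)
  rw [nhds_prod_eq, eventually_prod_iff] at h1
  obtain ⟨p, hp, q, hq, h⟩ := h1
  refine ⟨{r' | q r'}, mem_nhdsWithin_of_mem_nhds hq, ?_⟩
  filter_upwards [tendsto_comap.eventually hp] with i hi r' hr'
  have h2 := h hi hr'
  have h3 := h hp.self_of_nhds hr'
  have h4 := dist_triangle_right (f' x r') (f' (e i) r') (f' x r)
  simp only at h2 h3
  linarith

variable {S F : Type*} [NormedAddCommGroup S] [InnerProductSpace ℂ S]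
  [NormedAddCommGroup F] [InnerProductSpace ℂ F]

theorem continuous_productKet (ψ : S) (n : ℕ) : Continuous (productKet S F ψ n) :=
  continuous_ket_productVec ψ

variable [CompleteSpace S]

/-- By its definition `interaction` is i(H_Tot − H_0), so −i times it restores the difference. -/
theorem mem_totalHamiltonian (H L : S →L[ℂ] S) (h : F →ₗ.[ℂ] F) (g : F) (ψ : S) {n : ℕ}
    (x : Fin n → h.domain) :
    (productKet S F ψ n fun i => (x i : F), ket ψ (secondQuant h x) -
      Complex.I • interaction H L g (productKet S F) ψ n fun i => (x i : F)) ∈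
        totalHamiltonian H L h g := by
  refine Submodule.subset_span ⟨ψ, n, x, ?_⟩
  rw [interaction_productKet, smul_smul, Complex.I_mul_I, Prod.mk.injEq]
  refine ⟨rfl, ?_⟩
  module

/-- The commutator of the interaction with a creation operator. -/
theorem interaction_cons {E : Type*} [NormedAddCommGroup E] [NormedSpace ℂ E] (H L : S →L[ℂ] S)
    (γ k : F) {Z : S → (n : ℕ) → (Fin n → F) → E}
    (hZ : ∀ (ψ : S) (n : ℕ) (a b : F) (x : Fin n → F),
      Z ψ (n + 2) (Fin.cons a (Fin.cons b x : Fin (n + 1) → F)) =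
        Z ψ (n + 2) (Fin.cons b (Fin.cons a x : Fin (n + 1) → F)))
    (ψ : S) (n : ℕ) (x : Fin n → F) :
    interaction H L γ Z ψ (n + 1) (Fin.cons k x) =
      interaction H L γ (fun ψ n x => Z ψ (n + 1) (Fin.cons k x)) ψ n x +
        inner ℂ γ k • Z (ContinuousLinearMap.adjoint L ψ) n x := by
  have h1 : contract γ (Z (ContinuousLinearMap.adjoint L ψ)) (n + 1) (Fin.cons k x) =
      contract γ (fun n x => Z (ContinuousLinearMap.adjoint L ψ) (n + 1) (Fin.cons k x)) n x +
        inner ℂ γ k • Z (ContinuousLinearMap.adjoint L ψ) n x := by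
    rw [contract, Fin.sum_univ_succ, add_comm]
    congr 1
    · cases n with
      | zero => simp [contract]
      | succ n =>
        rw [contract]
        refine Finset.sum_congr rfl fun i _ => ?_
        rw [Fin.cons_succ]
        congr 2
        funext j
        refine Fin.cases ?_ (fun j => ?_) j <;> simp
  rw [interaction, interaction, h1, hZ, add_assoc]

variable [CompleteSpace F]

/-- The equation of motion of the interaction picture on all product vectors. -/
theorem hasDerivAt_interactionPicture {H L : S →L[ℂ] S} {h : F →ₗ.[ℂ] F} (hh : IsSelfAdjoint h)
    {g : F} {V : ℝ → Total S F →L[ℂ] Total S F} (hV : IsGroupOf (totalHamiltonian H L h g) V)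
    (ψ : S) (n : ℕ) (x : Fin n → F) (s : ℝ) :
    HasDerivAt (fun r => V (-r) (unitaryGroup (freeHamiltonian S h) r (productKet S F ψ n x)))
      (V (-s) (unitaryGroup (freeHamiltonian S h) s
        (interaction H L (unitaryGroup h.graph (-s) g) (productKet S F) ψ n x))) s := by
  have hu := isGroupOf_unitaryGroup (exists_isGroupOf_graph hh)
  obtain ⟨hW, hWu⟩ := unitaryGroup_freeHamiltonian (S := S) hh
  set u := unitaryGroup h.graph
  set W := unitaryGroup (freeHamiltonian S h)
  -- The operator h has cancelled from the right-hand side, which makes sense for all x, so factors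
  -- in the domain of h suffice.
  refine hasDerivAt_of_denseRange (denseRange_pi_domain hh.dense_domain n)
    (f := fun x r => V (-r) (W r (productKet S F ψ n x)))
    (f' := fun x s => V (-s) (W s (interaction H L (u (-s) g) (productKet S F) ψ n x)))
    (fun s => ?_) ?_ (fun x s => ?_) x s
  · exact (V (-s)).continuous.comp ((W s).continuous.comp (continuous_productKet ψ n))
  · have h1 := continuous_interaction H L (X := ℝ) (Z := fun _ => productKet S F)
      (fun ψ n => (continuous_productKet ψ n).comp continuous_snd)
      (γ := fun s => u (-s) g) ((hu.isUnitaryGroup.continuous g).comp continuous_neg) ψ n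
    have h2 := h1.comp (continuous_swap (X := Fin n → F) (Y := ℝ))
    have h3 := (continuous_apply_of_norm_map hW.isUnitaryGroup.norm_map
      hW.isUnitaryGroup.continuous).comp (continuous_snd.prodMk h2)
    exact (continuous_apply_of_norm_map (A := fun s => V (-s)) (fun t => hV.isUnitaryGroup.norm_map _)
      (fun x => (hV.isUnitaryGroup.continuous x).comp continuous_neg)).comp (continuous_snd.prodMk h3)
  · obtain ⟨y, hy, hy'⟩ := exists_domain_eq_group_apply hh hu hWu s ψ x
    have h1 : W s (productKet S F ψ n fun i => (x i : F)) = productKet S F ψ n fun i => (y i : F) := by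
      simp only [productKet, hWu, hy]
    have h2 : (productKet S F ψ n (fun i => (x i : F)), ket ψ (secondQuant h x)) ∈
        freeHamiltonian S h := Submodule.subset_span ⟨ψ, n, x, rfl⟩
    have h3 : interaction H L g (productKet S F) ψ n (fun i => (y i : F)) =
        W s (interaction H L (u (-s) g) (productKet S F) ψ n fun i => (x i : F)) := by
      rw [← ContinuousLinearMap.coe_coe, ← interaction_map]
      simp only [ContinuousLinearMap.coe_coe, productKet, hWu]
      have := interaction_comp_isometry H L (u (-s) g) (hu.isUnitaryGroup.norm_map s)
        (productKet S F) ψ n (fun i => (x i : F))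
      simp only [productKet, hu.isUnitaryGroup.apply_neg_apply] at this
      rw [this]
      simp only [hy]
    have h4 := mem_totalHamiltonian H L h g ψ y
    rw [← h1] at h4
    refine (hV.hasDerivAt_neg_apply_comp (hW.hasDerivAt_apply h2 s) h4).congr_deriv ?_
    rw [h3, hy', smul_sub, smul_smul, Complex.I_mul_I]
    congr 1
    simp only [map_smul]
    module

/-- The action of an annihilation operator on the evolved vacuum, in weak form. -/
theorem inner_creation_evolution {H L : S →L[ℂ] S} {h : F →ₗ.[ℂ] F} (hh : IsSelfAdjoint h)
    {g : F} {V : ℝ → Total S F →L[ℂ] Total S F} (hV : IsGroupOf (totalHamiltonian H L h g) V)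
    (φ : S) (k : F) (q : ℝ → Total S F) (hq : Continuous q)
    (hqV : ∀ s, q s = V (-s) (unitaryGroup (freeHamiltonian S h) s (systemOp L
      (unitaryGroup (freeHamiltonian S h) (-s) (V s (ket φ vac))))))
    (t : ℝ) (ψ : S) (n : ℕ) (x : Fin n → F) :
    inner ℂ (ket ψ (productVec (Fin.cons k x : Fin (n + 1) → F)))
        (unitaryGroup (freeHamiltonian S h) (-t) (V t (ket φ vac))) =
      inner ℂ (ket ψ (productVec x)) (unitaryGroup (freeHamiltonian S h) (-t) (V t
        (∫ s in (0 : ℝ)..t, inner ℂ k (unitaryGroup h.graph (-s) g) • q s))) := by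
  have hu := isGroupOf_unitaryGroup (exists_isGroupOf_graph hh)
  have hW := (unitaryGroup_freeHamiltonian (S := S) hh).1
  have hX := fun ψ n x s => hasDerivAt_interactionPicture hh hV ψ n x s
  set u := unitaryGroup h.graph
  set W := unitaryGroup (freeHamiltonian S h)
  have hUV := hV.isUnitaryGroup
  have hUW := hW.isUnitaryGroup
  set γ : ℝ → F := fun s => u (-s) g with hγ
  have hγc : Continuous γ := (hu.isUnitaryGroup.continuous g).comp continuous_neg
  let Q : ℝ → Total S F := fun t => ∫ s in (0 : ℝ)..t, inner ℂ k (γ s) • q s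
  have hqc : Continuous fun s => inner ℂ k (γ s) • q s :=
    (Continuous.inner (𝕜 := ℂ) continuous_const hγc).smul hq
  have hQ : ∀ t, HasDerivAt Q (inner ℂ k (γ t) • q t) t := fun t =>
    (hqc.integral_hasStrictDerivAt 0 t).hasDerivAt
  let X : ℝ → Total S F →L[ℂ] Total S F := fun s => V (-s) ∘L W s
  have hXn : ∀ s ξ, ‖X s ξ‖ = ‖ξ‖ := fun s ξ => by
    simp only [X, ContinuousLinearMap.comp_apply, hUV.norm_map, hUW.norm_map]
  have hXi : ∀ s ξ η, inner ℂ (X s ξ) η = inner ℂ ξ (W (-s) (V s η)) := fun s ξ η => by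
    simp only [X, ContinuousLinearMap.comp_apply, hUV.inner_apply_left, hUW.inner_apply_left,
      neg_neg]
  have hXi' : ∀ s ξ η, inner ℂ η (X s ξ) = inner ℂ (W (-s) (V s η)) ξ := fun s ξ η => by
    rw [← inner_conj_symm, hXi, inner_conj_symm]
  set Ω : Total S F := ket φ vac with hΩ
  -- With X_t = U_t^*, this is the conjugate of the defect of the claimed identity. It solves the
  -- homogeneous interaction equation: the commutator term ⟨γ_t, k⟩L^* from `interaction_cons`
  -- cancels the derivative of Q. The extra factor k is the reason for p = 1.
  let Z : ℝ → S → (n : ℕ) → (Fin n → F) → ℂ := fun t ψ n x =>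
    inner ℂ Ω (X t (productKet S F ψ (n + 1) (Fin.cons k x))) - inner ℂ (Q t) (X t (productKet S F ψ n x))
  have hZ : Z t ψ n x = 0 := by
    refine eq_zero_of_hasDerivAt_interaction H L (γ := γ) (G := ‖g‖) (Z := Z) (p := 1)
      (fun t => (hu.isUnitaryGroup.norm_map _ _).le) (fun T => ?_) (fun ψ n x => ?_)
      (fun t ψ n x => ?_) t ψ n x
    · have hQc : Continuous Q := continuous_iff_continuousAt.2 fun s => (hQ s).continuousAt
      obtain ⟨M, hM⟩ := (isCompact_Icc (a := -T) (b := T)).exists_bound_of_continuousOn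
        hQc.continuousOn
      refine ⟨‖Ω‖ * ‖k‖ + |M|, by positivity, fun s hs ψ n x => ?_⟩
      have hM' : ‖Q s‖ ≤ |M| := (hM s (abs_le.1 hs)).trans (le_abs_self M)
      have h1 := productBound_productKet (S := S) (F := F) ψ (n + 1) (Fin.cons k x)
      have h2 := productBound_productKet (S := S) (F := F) ψ n x
      rw [Fin.prod_univ_succ] at h1
      simp only [Fin.cons_zero, Fin.cons_succ, one_mul, add_zero] at h1 h2
      have h3 : √(n.factorial : ℝ) ≤ √((n + 1).factorial : ℝ) :=
        Real.sqrt_le_sqrt (by exact_mod_cast Nat.factorial_le (Nat.le_succ n))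
      set P := ∏ i, ‖x i‖
      have hP : 0 ≤ P := Finset.prod_nonneg fun _ _ => norm_nonneg _
      calc ‖Z s ψ n x‖ ≤ ‖Ω‖ * ‖productKet S F ψ (n + 1) (Fin.cons k x)‖ +
            ‖Q s‖ * ‖productKet S F ψ n x‖ := by
            refine (norm_sub_le _ _).trans (add_le_add ?_ ?_)
            · exact (norm_inner_le_norm _ _).trans (by rw [hXn])
            · exact (norm_inner_le_norm _ _).trans (by rw [hXn])
        _ ≤ ‖Ω‖ * (√((n + 1).factorial : ℝ) * (‖ψ‖ * (‖k‖ * P))) +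
            |M| * (√((n + 1).factorial : ℝ) * (‖ψ‖ * P)) := by
            gcongr
            exact h2.trans (by gcongr)
        _ = _ := by ring
    · have h1 : X 0 = 1 := by
        simp only [X, neg_zero, hUV.map_zero, hUW.map_zero]
        rfl
      simp only [Z, h1, one_apply_eq_self, Q, intervalIntegral.integral_same, inner_zero_left,
        sub_zero]
      rw [hΩ, productKet, inner_ket, vac, inner_productVec_of_ne (Nat.succ_ne_zero n).symm, mul_zero]
    · have h1 := ((hasDerivAt_const t Ω).inner ℂ (hX ψ (n + 1) (Fin.cons k x) t)).sub
        ((hQ t).inner ℂ (hX ψ n x t))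
      refine h1.congr_deriv ?_
      have h2 := interaction_sub H L (γ t)
        (fun ψ n x => inner ℂ Ω (X t (productKet S F ψ (n + 1) (Fin.cons k x))))
        (fun ψ n x => inner ℂ (Q t) (X t (productKet S F ψ n x))) ψ n x
      have h3 := interaction_map ((innerSL ℂ Ω).comp (X t)).toLinearMap H L (γ t)
        (fun ψ n x => productKet S F ψ (n + 1) (Fin.cons k x)) ψ n x
      have h4 := interaction_map ((innerSL ℂ (Q t)).comp (X t)).toLinearMap H L (γ t)
        (productKet S F) ψ n x
      simp only [ContinuousLinearMap.coe_coe, ContinuousLinearMap.comp_apply,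
        innerSL_apply_apply] at h3 h4
      rw [h2, h3, h4]
      have h5 := interaction_cons H L (γ t) k (Z := productKet S F)
        (fun ψ n a b x => by simp only [productKet, productVec_cons_cons a b x]) ψ n x
      -- Here q_t = U_t^*(L⊗1)U_tΩ; the outer U_t^* cancels against X_t and L moves across as its
      -- adjoint.
      have h6 : inner ℂ (q t) (X t (productKet S F ψ n x)) =
          inner ℂ Ω (X t (productKet S F (ContinuousLinearMap.adjoint L ψ) n x)) := by
        rw [hXi', hXi', hqV, hUV.apply_neg_apply, hUW.neg_apply_apply, productKet,
          inner_systemOp_ket, productKet]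
      have h7 : V (-t) (W t (interaction H L (γ t) (productKet S F) ψ (n + 1) (Fin.cons k x))) =
          X t (interaction H L (γ t) (fun ψ n x => productKet S F ψ (n + 1) (Fin.cons k x)) ψ n x) +
            inner ℂ (γ t) k • X t (productKet S F (ContinuousLinearMap.adjoint L ψ) n x) := by
        rw [h5, map_add, map_add, map_smul, map_smul]
        rfl
      rw [h7, inner_add_right, inner_smul_right, inner_smul_left, inner_zero_left, add_zero,
        inner_conj_symm]
      change _ - (_ + _ * inner ℂ (q t) (X t (productKet S F ψ n x))) = _
      rw [h6]
      simp only [X, ContinuousLinearMap.comp_apply, hγ]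
      ring
  simp only [Z, sub_eq_zero] at hZ
  have h1 := congrArg (starRingEnd ℂ) hZ
  rw [inner_conj_symm, inner_conj_symm, hXi, hXi] at h1
  exact h1

end InteractionPicture

/-! ### Differentiation of exponential vectors and of hybrid representations. -/

section Hybrid

variable {S F : Type*} [NormedAddCommGroup S] [InnerProductSpace ℂ S] [CompleteSpace S]
  [NormedAddCommGroup F] [InnerProductSpace ℂ F]

/-- The derivative of the exponential vector `e^{f + δk}` at `δ = 0`. -/
theorem hasDerivAt_expVec (f k : F) :
    ∃ Φ : Fock F, HasDerivAt (fun δ : ℂ => expVec (f + δ • k)) Φ 0 ∧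
      HasSum (fun n : ℕ => (n.factorial : ℂ)⁻¹ •
        productVec (Fin.cons k (fun _ => f) : Fin (n + 1) → F)) Φ := by
  set R := ‖f‖ + ‖k‖
  let g' : ℕ → ℂ → Fock F := fun n δ => (n.factorial : ℂ)⁻¹ •
    ∑ i : Fin n, productVec (Function.update (fun _ : Fin n => f + δ • k) i k)
  have hs := summable_pow_mul_sqrt_factorial (2 * R) (by positivity) 0
  have hg' : ∀ n δ, δ ∈ Metric.ball (0 : ℂ) 1 →
      ‖g' n δ‖ ≤ (2 * R) ^ n / n.factorial * √((0 + n).factorial : ℝ) := by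
    intro n δ hδ
    rw [mem_ball_zero_iff] at hδ
    have h1 : ∀ i : Fin n, ‖productVec (Function.update (fun _ : Fin n => f + δ • k) i k)‖ ≤
        √(n.factorial : ℝ) * R ^ n := by
      intro i
      refine (norm_productVec_le _).trans ?_
      gcongr
      refine (Finset.prod_le_prod (g := fun _ => R) (fun _ _ => norm_nonneg _) fun j _ => ?_).trans
        (by simp)
      by_cases hj : j = i
      · subst hj
        simp [R]
      · rw [Function.update_of_ne hj]
        refine (norm_add_le _ _).trans ?_
        rw [norm_smul]
        have : ‖δ‖ * ‖k‖ ≤ 1 * ‖k‖ := by gcongr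
        linarith
    rw [norm_smul, norm_inv, Complex.norm_natCast, zero_add, mul_pow]
    -- The factor n comes from differentiating each of n equal slots; it is absorbed by replacing R
    -- with 2R.
    have h2 : (n : ℝ) ≤ 2 ^ n := by exact_mod_cast Nat.lt_two_pow_self.le
    calc _ ≤ (n.factorial : ℝ)⁻¹ * ∑ i : Fin n, √(n.factorial : ℝ) * R ^ n := by
          gcongr
          exact norm_sum_le_of_le _ fun i _ => h1 i
      _ = (n.factorial : ℝ)⁻¹ * (n * (√(n.factorial : ℝ) * R ^ n)) := by simp
      _ ≤ (n.factorial : ℝ)⁻¹ * (2 ^ n * (√(n.factorial : ℝ) * R ^ n)) := by gcongr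
      _ = _ := by ring
  have hd := hasDerivAt_tsum_of_isPreconnected (𝕜 := ℂ) (y₀ := (0 : ℂ)) (y := 0)
    (g := fun (n : ℕ) (δ : ℂ) => (n.factorial : ℂ)⁻¹ • productVec (fun _ : Fin n => f + δ • k))
    (g' := g') hs Metric.isOpen_ball
    (convex_ball (0 : ℂ) 1).isPreconnected (fun n δ _ => ?_) hg' (by simp)
    (by simpa using summable_expVec f) (by simp)
  · refine ⟨_, hd, ?_⟩
    have h0 : (0 : ℂ) ∈ Metric.ball (0 : ℂ) 1 := by simp
    have h1 : Summable fun n => g' n 0 := Summable.of_norm_bounded hs fun n => hg' n 0 h0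
    -- The term n = 0 is constant in δ, so the derivative series starts at n = 1 and is reindexed;
    -- n+1 equal summands turn 1/(n+1)! into 1/n!.
    have h2 := (hasSum_nat_add_iff' 1).2 h1.hasSum
    refine HasSum.congr_fun ?_ (f := fun n => g' (n + 1) 0) ?_
    · simpa [g'] using h2
    · intro n
      simp only [g', zero_smul, add_zero, productVec_update_const, Finset.sum_const,
        Finset.card_univ, Fintype.card_fin]
      rw [← Nat.cast_smul_eq_nsmul ℂ, smul_smul, Nat.factorial_succ]
      congr 1
      push_cast
      have : (n : ℂ) + 1 ≠ 0 := by exact_mod_cast n.succ_ne_zero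
      field_simp
  · have h1 : HasDerivAt (fun δ : ℂ => f + δ • k) k δ := by
      simpa using ((hasDerivAt_id δ).smul_const k).const_add f
    exact (hasDerivAt_productVec_complex (n := n) (u := fun δ _ => f + δ • k)
      (u' := fun _ => k) fun _ => h1).fun_const_smul _

/-- Partial inner product with a vector of the Fock space. -/
def partialInner (Ξ : Total S F) (Φ : Fock F) : S :=
  ContinuousLinearMap.adjoint (ketCLM (S := S) Φ) Ξ

theorem inner_partialInner (Ξ : Total S F) (Φ : Fock F) (ψ : S) :
    inner ℂ ψ (partialInner Ξ Φ) = inner ℂ (ket ψ Φ) Ξ := by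
  rw [partialInner, ContinuousLinearMap.adjoint_inner_right, ketCLM_apply]

theorem norm_partialInner_le (Ξ : Total S F) (Φ : Fock F) : ‖partialInner Ξ Φ‖ ≤ ‖Ξ‖ * ‖Φ‖ := by
  have h1 : ‖ketCLM (S := S) Φ‖ ≤ ‖Φ‖ := ContinuousLinearMap.opNorm_le_bound _ (norm_nonneg _)
    fun ψ => by rw [ketCLM_apply, norm_ket, mul_comm]
  refine (ContinuousLinearMap.le_opNorm _ _).trans ?_
  rw [LinearIsometryEquiv.norm_map, mul_comm]
  gcongr

theorem partialInner_sub_sub_smul (Ξ : Total S F) (Φ Φ' Φ'' : Fock F) (c : ℂ) :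
    partialInner Ξ (Φ - Φ' - c • Φ'') =
      partialInner Ξ Φ - partialInner Ξ Φ' - starRingEnd ℂ c • partialInner Ξ Φ'' := by
  refine ext_inner_left ℂ fun ψ => ?_
  simp only [inner_partialInner, inner_sub_right, inner_smul_right, ← ketRight_apply, map_sub,
    map_smul, inner_sub_left, inner_smul_left]

/-- The hypothesis says a(k)Ξ = Θ weakly, and e^f has derivative a(k)^* e^f along k. Pairing is
antilinear in the exponential vector, so the conjugate on ε is what yields a complex derivative. -/
theorem hasDerivAt_hybrid {Ξ Θ : Total S F} {k : F}
    (hΞ : ∀ (ψ : S) (n : ℕ) (x : Fin n → F),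
      inner ℂ (ket ψ (productVec (Fin.cons k x : Fin (n + 1) → F))) Ξ =
        inner ℂ (ket ψ (productVec x)) Θ) (f : F) :
    HasDerivAt (fun ε : ℂ => hybrid Ξ (f + starRingEnd ℂ ε • k)) (hybrid Θ f) 0 := by
  obtain ⟨Φ, hΦ, hsum⟩ := hasDerivAt_expVec f k
  have h1 : partialInner Ξ Φ = hybrid Θ f := by
    refine ext_inner_left ℂ fun ψ => ?_
    rw [inner_partialInner, inner_hybrid, ← inner_conj_symm, ← inner_conj_symm (ket ψ (expVec f))]
    congr 1
    have h2 := ((innerSL ℂ Ξ).comp (ketRight ψ)).hasSum hsum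
    have h3 := ((innerSL ℂ Θ).comp (ketRight ψ)).hasSum (summable_expVec f).hasSum
    refine h2.unique (h3.congr_fun fun n => ?_)
    simp only [map_smul, ContinuousLinearMap.comp_apply, innerSL_apply_apply,
      ketRight_apply]
    congr 1
    rw [← inner_conj_symm, hΞ, inner_conj_symm]
  rw [← h1, hasDerivAt_iff_isLittleO]
  rw [hasDerivAt_iff_isLittleO] at hΦ
  have hconj : Tendsto (starRingEnd ℂ) (𝓝 0) (𝓝 0) := by
    simpa using Complex.continuous_conj.tendsto 0
  have h2 := hΦ.comp_tendsto hconj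
  refine (Asymptotics.IsBigO.of_bound ‖Ξ‖ (Eventually.of_forall fun ε => ?_)).trans_isLittleO
    (h2.trans_isBigO (Asymptotics.IsBigO.of_bound 1 (Eventually.of_forall fun ε => ?_)))
  · have h3 := norm_partialInner_le Ξ (expVec (f + starRingEnd ℂ ε • k) -
      expVec (f + (0 : ℂ) • k) - (starRingEnd ℂ ε - 0) • Φ)
    rw [partialInner_sub_sub_smul, map_sub, map_zero, Complex.conj_conj] at h3
    simpa [hybrid, partialInner] using h3
  · simp

end Hybrid

/-! ### Inner products of series, regrouped by total order. -/

section CauchyProduct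

variable {E : Type*} [NormedAddCommGroup E] [InnerProductSpace ℂ E] [CompleteSpace E]

theorem inner_tsum_tsum_eq_tsum_sum_antidiagonal {a b : ℕ → E} (ha : Summable fun n => ‖a n‖)
    (hb : Summable fun n => ‖b n‖) :
    inner ℂ (∑' j, a j) (∑' k, b k) =
      ∑' N, ∑ p ∈ Finset.HasAntidiagonal.antidiagonal N, inner ℂ (a p.1) (b p.2) := by
  have h1 : Summable fun p : ℕ × ℕ => inner ℂ (a p.1) (b p.2) :=
    Summable.of_norm_bounded
      (ha.mul_of_nonneg hb (fun _ => norm_nonneg _) fun _ => norm_nonneg _)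
      fun p => norm_inner_le_norm _ _
  have h2 : ∀ x, inner ℂ x (∑' k, b k) = ∑' k, inner ℂ x (b k) := fun x =>
    (innerSL ℂ x).map_tsum hb.of_norm
  have h3 : ∀ y, inner ℂ (∑' j, a j) y = ∑' j, inner ℂ (a j) y := fun y => by
    rw [← inner_conj_symm, ← innerSL_apply_apply, (innerSL ℂ y).map_tsum ha.of_norm,
      Complex.conj_tsum]
    simp only [innerSL_apply_apply, inner_conj_symm]
  rw [h3]
  simp only [h2]
  rw [← h1.tsum_prod, ← Finset.HasAntidiagonal.sigmaAntidiagonalEquivProd.tsum_eq, Summable.tsum_sigma']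
  · refine tsum_congr fun N => ?_
    rw [tsum_fintype, ← Finset.sum_coe_sort (Finset.HasAntidiagonal.antidiagonal N)]
    rfl
  · exact fun N => (hasSum_fintype _).summable
  · exact (Finset.HasAntidiagonal.sigmaAntidiagonalEquivProd.summable_iff).2 h1

end CauchyProduct

/-! ### The Dyson series and the group generated by the total Hamiltonian. -/

section Dyson

variable {S F : Type*} [NormedAddCommGroup S] [InnerProductSpace ℂ S] [CompleteSpace S]
  [NormedAddCommGroup F] [InnerProductSpace ℂ F]

theorem interaction_sum {E ι : Type*} [NormedAddCommGroup E] [NormedSpace ℂ E] (s : Finset ι)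
    (H L : S →L[ℂ] S) (γ : F) (Z : ι → S → (n : ℕ) → (Fin n → F) → E) (ψ : S) (n : ℕ)
    (x : Fin n → F) :
    interaction H L γ (fun ψ n x => ∑ i ∈ s, Z i ψ n x) ψ n x =
      ∑ i ∈ s, interaction H L γ (Z i) ψ n x := by
  have h1 : contract γ (fun n x => ∑ i ∈ s, Z i (ContinuousLinearMap.adjoint L ψ) n x) n x =
      ∑ i ∈ s, contract γ (Z i (ContinuousLinearMap.adjoint L ψ)) n x := by
    cases n with
    | zero => simp [contract]
    | succ n =>
      simp only [contract, Finset.smul_sum]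
      rw [Finset.sum_comm]
  simp only [interaction, h1, Finset.smul_sum, Finset.sum_add_distrib, Finset.sum_sub_distrib]

theorem hasSum_interaction {E ι : Type*} [NormedAddCommGroup E] [NormedSpace ℂ E]
    (H L : S →L[ℂ] S) (γ : F) {Z : ι → S → (n : ℕ) → (Fin n → F) → E}
    {Y : S → (n : ℕ) → (Fin n → F) → E} (h : ∀ ψ n x, HasSum (fun i => Z i ψ n x) (Y ψ n x)) (ψ : S)
    (n : ℕ) (x : Fin n → F) :
    HasSum (fun i => interaction H L γ (Z i) ψ n x) (interaction H L γ Y ψ n x) := by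
  refine (((h _ _ _).const_smul _).sub (h _ _ _)).add ?_
  cases n with
  | zero => exact hasSum_zero
  | succ n => exact hasSum_sum fun i _ => (h _ _ _).const_smul _

/-- The interaction is i times a symmetric operator, since creation and annihilation are mutually
adjoint. -/
theorem inner_interaction_productKet (H L : S →L[ℂ] S) (hH : IsSelfAdjoint H) (γ : F) (ψ : S)
    (n : ℕ) (x : Fin n → F) (ψ' : S) (m : ℕ) (y : Fin m → F) :
    inner ℂ (interaction H L γ (productKet S F) ψ n x) (productKet S F ψ' m y) +
      inner ℂ (productKet S F ψ n x) (interaction H L γ (productKet S F) ψ' m y) = 0 := by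
  have h1 : inner ℂ (productVec x) (creation γ y) = inner ℂ (annihilation γ x) (productVec y) := by
    rw [← inner_conj_symm, inner_creation_productVec, inner_conj_symm]
  have h2 : inner ℂ (H ψ) ψ' = inner ℂ ψ (H ψ') :=
    ContinuousLinearMap.isSelfAdjoint_iff_isSymmetric.1 hH ψ ψ'
  simp only [interaction_productKet, productKet, inner_smul_left, inner_smul_right, inner_add_left,
    inner_add_right, inner_sub_left, inner_sub_right, inner_ket, inner_creation_productVec, h1, h2,
    ContinuousLinearMap.adjoint_inner_left, ContinuousLinearMap.adjoint_inner_right,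
    Complex.conj_I]
  ring

/-- The terms of the Dyson series of the interaction picture evolution. -/
def dysonTerm (H L : S →L[ℂ] S) (γ : ℝ → F) :
    ℕ → ℝ → S → (n : ℕ) → (Fin n → F) → Total S F
  | 0, _ => productKet S F
  | N + 1, t => fun ψ n x => ∫ s in (0 : ℝ)..t, interaction H L (γ s) (dysonTerm H L γ N s) ψ n x

variable {H L : S →L[ℂ] S} {γ : ℝ → F} {G : ℝ}

theorem continuous_dysonTerm (hγ : Continuous γ) (N : ℕ) (ψ : S) (n : ℕ) :
    Continuous fun p : ℝ × (Fin n → F) => dysonTerm H L γ N p.1 ψ n p.2 := by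
  induction N generalizing ψ n with
  | zero => exact (continuous_productKet ψ n).comp continuous_snd
  | succ N ih =>
    have h1 := continuous_interaction H L ih hγ ψ n
    refine intervalIntegral.continuous_parametric_intervalIntegral_of_continuous
      (f := fun (p : ℝ × (Fin n → F)) s => interaction H L (γ s) (dysonTerm H L γ N s) ψ n p.2)
      ?_ continuous_fst
    exact h1.comp (g := fun p : ℝ × (Fin n → F) =>
      interaction H L (γ p.1) (dysonTerm H L γ N p.1) ψ n p.2)
      (f := fun q : (ℝ × (Fin n → F)) × ℝ => (q.2, q.1.2)) (by fun_prop)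

theorem hasDerivAt_dysonTerm_succ (hγ : Continuous γ) (N : ℕ) (ψ : S) (n : ℕ) (x : Fin n → F)
    (t : ℝ) : HasDerivAt (fun s => dysonTerm H L γ (N + 1) s ψ n x)
      (interaction H L (γ t) (dysonTerm H L γ N t) ψ n x) t := by
  have h1 := continuous_interaction H L (continuous_dysonTerm (H := H) (L := L) hγ N) hγ ψ n
  have h2 : Continuous fun s => interaction H L (γ s) (dysonTerm H L γ N s) ψ n x :=
    h1.comp (g := fun p : ℝ × (Fin n → F) =>
      interaction H L (γ p.1) (dysonTerm H L γ N p.1) ψ n p.2) (by fun_prop : Continuous fun s => (s, x))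
  exact (h2.integral_hasStrictDerivAt 0 t).hasDerivAt

theorem dysonTerm_succ_zero (N : ℕ) (ψ : S) (n : ℕ) (x : Fin n → F) :
    dysonTerm H L γ (N + 1) 0 ψ n x = 0 :=
  intervalIntegral.integral_same

/-- Each interaction contributes a constant and one unit of weight, and the N nested time integrals
contribute |t|^N/N!. -/
theorem productBound_dysonTerm (hγ : Continuous γ) (hG : ∀ t, ‖γ t‖ ≤ G) (N : ℕ) (t : ℝ) :
    ProductBound ((‖H‖ + 2 * (‖L‖ * G)) ^ N * (|t| ^ N / N.factorial)) N
      (dysonTerm H L γ N t) := by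
  have hG0 : 0 ≤ G := (norm_nonneg _).trans (hG 0)
  set C := ‖H‖ + 2 * (‖L‖ * G) with hC
  have hC0 : 0 ≤ C := by positivity
  induction N generalizing t with
  | zero =>
    have h1 : (C ^ 0 * (|t| ^ 0 / (Nat.factorial 0 : ℝ))) = 1 := by simp
    rw [h1]
    exact productBound_productKet
  | succ N ih =>
    intro ψ n x
    have h2 := norm_le_of_hasDerivAt (t := t) (N := N) (dysonTerm_succ_zero N ψ n x)
      (fun r => hasDerivAt_dysonTerm_succ (H := H) (L := L) hγ N ψ n x r)
      (M := C ^ N / N.factorial * C * √((n + (N + 1)).factorial : ℝ) *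
          (‖ψ‖ * ∏ i, ‖x i‖)) fun r hr => by
        refine ((ih r).interaction H L (by positivity) (hG r) ψ n x).trans (le_of_eq ?_)
        rw [← hC]
        ring
    refine h2.trans (le_of_eq ?_)
    rw [Nat.factorial_succ, pow_succ C]
    push_cast
    field_simp

theorem summable_norm_dysonTerm (hγ : Continuous γ) (hG : ∀ t, ‖γ t‖ ≤ G) (t : ℝ) (ψ : S) (n : ℕ)
    (x : Fin n → F) : Summable fun N => ‖dysonTerm H L γ N t ψ n x‖ := by
  have hG0 : 0 ≤ G := (norm_nonneg _).trans (hG 0)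
  have h1 := (summable_pow_mul_sqrt_factorial ((‖H‖ + 2 * (‖L‖ * G)) * |t|) (by positivity)
    n).mul_right (‖ψ‖ * ∏ i, ‖x i‖)
  refine Summable.of_nonneg_of_le (fun _ => norm_nonneg _) (fun N => ?_) h1
  refine (productBound_dysonTerm hγ hG N t ψ n x).trans (le_of_eq ?_)
  rw [mul_pow]
  ring

/-- Isometry of the Dyson series holds order by order: the sum is the order N+1 part of ⟨R_t p, R_t
p'⟩. It vanishes at t = 0 and its time derivative is zero. -/
theorem sum_antidiagonal_inner_dysonTerm (hH : IsSelfAdjoint H) (hγ : Continuous γ) (N : ℕ) (t : ℝ)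
    (ψ : S) (n : ℕ) (x : Fin n → F) (ψ' : S) (m : ℕ) (y : Fin m → F) :
    ∑ p ∈ Finset.HasAntidiagonal.antidiagonal (N + 1),
      inner ℂ (dysonTerm H L γ p.1 t ψ n x) (dysonTerm H L γ p.2 t ψ' m y) = 0 := by
  -- If the order M sum is zero for all arguments, it stays zero with an interaction inserted in one
  -- argument.
  have hslot : ∀ (M : ℕ) (s : ℝ), (∀ (ψ : S) (n : ℕ) (x : Fin n → F) (ψ' : S) (m : ℕ) (y : Fin m → F),
      ∑ p ∈ Finset.HasAntidiagonal.antidiagonal M,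
        inner ℂ (dysonTerm H L γ p.1 s ψ n x) (dysonTerm H L γ p.2 s ψ' m y) = 0) →
      ∀ (ψ : S) (n : ℕ) (x : Fin n → F) (ψ' : S) (m : ℕ) (y : Fin m → F),
      ∑ p ∈ Finset.HasAntidiagonal.antidiagonal M, inner ℂ (dysonTerm H L γ p.1 s ψ n x)
        (interaction H L (γ s) (dysonTerm H L γ p.2 s) ψ' m y) = 0 := by
    intro M s hM ψ n x ψ' m y
    have h1 : ∀ p : ℕ × ℕ, inner ℂ (dysonTerm H L γ p.1 s ψ n x)
        (interaction H L (γ s) (dysonTerm H L γ p.2 s) ψ' m y) =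
        interaction H L (γ s) (fun ψ' m y => inner ℂ (dysonTerm H L γ p.1 s ψ n x)
          (dysonTerm H L γ p.2 s ψ' m y)) ψ' m y := fun p =>
      (interaction_map (innerSL ℂ (dysonTerm H L γ p.1 s ψ n x)).toLinearMap H L (γ s)
        (dysonTerm H L γ p.2 s) ψ' m y).symm
    rw [Finset.sum_congr rfl fun p _ => h1 p, ← interaction_sum]
    simp only [hM, interaction]
    cases m <;> simp [contract]
  have hder : ∀ (M : ℕ) (s : ℝ) (ψ : S) (n : ℕ) (x : Fin n → F) (ψ' : S) (m : ℕ) (y : Fin m → F),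
      ∑ p ∈ Finset.HasAntidiagonal.antidiagonal M,
        (inner ℂ (dysonTerm H L γ p.1 s ψ n x)
            (interaction H L (γ s) (dysonTerm H L γ p.2 s) ψ' m y) +
          inner ℂ (interaction H L (γ s) (dysonTerm H L γ p.1 s) ψ n x)
            (dysonTerm H L γ p.2 s ψ' m y)) = 0 → 
      HasDerivAt (fun r => ∑ p ∈ Finset.HasAntidiagonal.antidiagonal (M + 1),
        inner ℂ (dysonTerm H L γ p.1 r ψ n x) (dysonTerm H L γ p.2 r ψ' m y)) 0 s := by
    intro M s ψ n x ψ' m y hM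
    -- The zeroth term is constant in time; differentiating any other term lowers its index by one.
    -- Splitting off the ends of the antidiagonal therefore leaves two sums of order M.
    let d : ℕ → S → (n : ℕ) → (Fin n → F) → Total S F := fun j ψ n x =>
      Nat.casesOn j 0 fun j => interaction H L (γ s) (dysonTerm H L γ j s) ψ n x
    have hd : ∀ j ψ n x, HasDerivAt (fun r => dysonTerm H L γ j r ψ n x) (d j ψ n x) s := by
      intro j ψ n x
      cases j with
      | zero => exact hasDerivAt_const _ _
      | succ j => exact hasDerivAt_dysonTerm_succ hγ j ψ n x s
    have h1 := HasDerivAt.fun_sum (u := Finset.HasAntidiagonal.antidiagonal (M + 1)) fun p _ =>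
      (hd p.1 ψ n x).inner ℂ (hd p.2 ψ' m y)
    refine h1.congr_deriv ?_
    rw [Finset.sum_add_distrib] at hM ⊢
    rw [← hM]
    congr 1
    · rw [Finset.Nat.sum_antidiagonal_succ']
      simp [d]
    · rw [Finset.Nat.sum_antidiagonal_succ]
      simp [d]
  induction N generalizing t ψ n x ψ' m y with
  | zero =>
    have h1 : ∀ s, HasDerivAt (fun r => ∑ p ∈ Finset.HasAntidiagonal.antidiagonal (0 + 1),
        inner ℂ (dysonTerm H L γ p.1 r ψ n x) (dysonTerm H L γ p.2 r ψ' m y)) 0 s := by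
      intro s
      refine hder 0 s ψ n x ψ' m y ?_
      -- Only at lowest order is antisymmetry needed; at higher orders each of the two sums vanishes
      -- separately by induction.
      have := inner_interaction_productKet H L hH (γ s) ψ n x ψ' m y
      simpa [dysonTerm, add_comm] using this
    rw [is_const_of_deriv_eq_zero (fun s => (h1 s).differentiableAt) (fun s => (h1 s).deriv) t 0]
    simp [Finset.Nat.sum_antidiagonal_succ, dysonTerm_succ_zero]
  | succ N ih =>
    have h1 : ∀ s, HasDerivAt (fun r => ∑ p ∈ Finset.HasAntidiagonal.antidiagonal (N + 1 + 1),
        inner ℂ (dysonTerm H L γ p.1 r ψ n x) (dysonTerm H L γ p.2 r ψ' m y)) 0 s := by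
      intro s
      refine hder (N + 1) s ψ n x ψ' m y ?_
      rw [Finset.sum_add_distrib, hslot (N + 1) s (ih s), zero_add]
      have h2 := congrArg (starRingEnd ℂ) (hslot (N + 1) s (ih s) ψ' m y ψ n x)
      rw [map_sum, map_zero] at h2
      simp only [inner_conj_symm] at h2
      rw [← Finset.Nat.sum_antidiagonal_swap]
      exact h2
    rw [is_const_of_deriv_eq_zero (fun s => (h1 s).differentiableAt) (fun s => (h1 s).deriv) t 0]
    refine Finset.sum_eq_zero fun p hp => ?_
    obtain ⟨j, k⟩ := p
    cases j with
    | succ j => simp [dysonTerm_succ_zero]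
    | zero =>
      rw [Finset.HasAntidiagonal.mem_antidiagonal, zero_add] at hp
      simp only at hp
      subst hp
      simp [dysonTerm_succ_zero]

theorem inner_tsum_dysonTerm [CompleteSpace F] (hH : IsSelfAdjoint H) (hγ : Continuous γ)
    (hG : ∀ t, ‖γ t‖ ≤ G) (t : ℝ) (ψ : S) (n : ℕ) (x : Fin n → F) (ψ' : S) (m : ℕ) (y : Fin m → F) :
    inner ℂ (∑' N, dysonTerm H L γ N t ψ n x) (∑' N, dysonTerm H L γ N t ψ' m y) =
      inner ℂ (productKet S F ψ n x) (productKet S F ψ' m y) := by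
  rw [inner_tsum_tsum_eq_tsum_sum_antidiagonal (summable_norm_dysonTerm hγ hG t ψ n x)
    (summable_norm_dysonTerm hγ hG t ψ' m y), tsum_eq_single 0]
  · simp [dysonTerm]
  · intro N hN
    obtain ⟨N, rfl⟩ := Nat.exists_eq_succ_of_ne_zero hN
    exact sum_antidiagonal_inner_dysonTerm hH hγ N t ψ n x ψ' m y

/-- A summable bound uniform for |s| ≤ T, which is what termwise differentiation of the Dyson series
requires. -/
theorem norm_interaction_dysonTerm_le (hγ : Continuous γ) (hG : ∀ t, ‖γ t‖ ≤ G) (N : ℕ) {s T : ℝ}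
    (hs : |s| ≤ T) (ψ : S) (n : ℕ) (x : Fin n → F) :
    ‖interaction H L (γ s) (dysonTerm H L γ N s) ψ n x‖ ≤
      (‖H‖ + 2 * (‖L‖ * G)) * (‖ψ‖ * ∏ i, ‖x i‖) *
        (((‖H‖ + 2 * (‖L‖ * G)) * T) ^ N / N.factorial * √((n + 1 + N).factorial : ℝ)) := by
  have hG0 : 0 ≤ G := (norm_nonneg _).trans (hG 0)
  refine ((productBound_dysonTerm hγ hG N s).interaction H L (by positivity) (hG s) ψ n x).trans ?_
  rw [show n + (N + 1) = n + 1 + N by ring]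
  generalize hC : ‖H‖ + 2 * (‖L‖ * G) = C
  have hC0 : 0 ≤ C := by rw [← hC]; positivity
  have hP : 0 ≤ ∏ i, ‖x i‖ := Finset.prod_nonneg fun _ _ => norm_nonneg _
  have h2 : |s| ^ N ≤ T ^ N := by gcongr
  calc _ ≤ C ^ N * (T ^ N / N.factorial) * C * √((n + 1 + N).factorial : ℝ) *
        (‖ψ‖ * ∏ i, ‖x i‖) := by gcongr
    _ = _ := by
      rw [mul_pow]
      ring

theorem hasDerivAt_tsum_dysonTerm (hγ : Continuous γ) (hG : ∀ t, ‖γ t‖ ≤ G) [CompleteSpace F]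
    (t : ℝ) (ψ : S) (n : ℕ) (x : Fin n → F) :
    HasDerivAt (fun s => ∑' N, dysonTerm H L γ N s ψ n x)
      (interaction H L (γ t) (fun ψ n x => ∑' N, dysonTerm H L γ N t ψ n x) ψ n x) t := by
  have hG0 : 0 ≤ G := (norm_nonneg _).trans (hG 0)
  have hsum : ∀ s ψ n x, Summable fun N => dysonTerm H L γ N s ψ n x := fun s ψ n x =>
    (summable_norm_dysonTerm hγ hG s ψ n x).of_norm
  have h2 := (summable_pow_mul_sqrt_factorial ((‖H‖ + 2 * (‖L‖ * G)) * (|t| + 1)) (by positivity)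
    (n + 1)).mul_left ((‖H‖ + 2 * (‖L‖ * G)) * (‖ψ‖ * ∏ i, ‖x i‖))
  have hball : ∀ s ∈ Metric.ball (0 : ℝ) (|t| + 1), |s| ≤ |t| + 1 := fun s hs => by
    rw [mem_ball_zero_iff, Real.norm_eq_abs] at hs
    exact hs.le
  have ht : t ∈ Metric.ball (0 : ℝ) (|t| + 1) := by
    rw [mem_ball_zero_iff, Real.norm_eq_abs]
    linarith
  have h3 : HasDerivAt (fun s => ∑' N, dysonTerm H L γ (N + 1) s ψ n x)
      (∑' N, interaction H L (γ t) (dysonTerm H L γ N t) ψ n x) t :=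
    hasDerivAt_tsum_of_isPreconnected h2 Metric.isOpen_ball
      (convex_ball (0 : ℝ) _).isPreconnected
      (fun N s _ => hasDerivAt_dysonTerm_succ hγ N ψ n x s)
      (fun N s hs => norm_interaction_dysonTerm_le hγ hG N (hball s hs) ψ n x) ht
      ((summable_nat_add_iff 1).2 (hsum t ψ n x)) ht
  rw [(hasSum_interaction H L (γ t) (fun ψ n x => (hsum t ψ n x).hasSum) ψ n x).tsum_eq] at h3
  have h4 : (fun s => ∑' N, dysonTerm H L γ N s ψ n x) =
      fun s => productKet S F ψ n x + ∑' N, dysonTerm H L γ (N + 1) s ψ n x :=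
    funext fun s => (hsum s ψ n x).tsum_eq_zero_add
  rw [h4]
  exact h3.const_add _

/-- The interaction picture evolution `t ↦ U_t*`. -/
theorem exists_interactionPicture [CompleteSpace F] (hH : IsSelfAdjoint H) (hγ : Continuous γ)
    (hG : ∀ t, ‖γ t‖ ≤ G) :
    ∃ R : ℝ → Total S F →L[ℂ] Total S F, R 0 = 1 ∧ (∀ t ξ, ‖R t ξ‖ = ‖ξ‖) ∧
      (∀ ξ, Continuous fun t => R t ξ) ∧
      ∀ t ψ n x, HasDerivAt (fun s => R s (productKet S F ψ n x))
        (R t (interaction H L (γ t) (productKet S F) ψ n x)) t := by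
  have h1 : ∀ t, ∃ U : Total S F →L[ℂ] Total S F, (∀ ξ, ‖U ξ‖ = ‖ξ‖) ∧
      ∀ p : S × Σ n : ℕ, Fin n → F, U (ketFamily S F p) =
        ∑' N, dysonTerm H L γ N t p.1 p.2.1 p.2.2 := fun t =>
    exists_isometry_of_inner_eq _ _ span_ketFamily fun p q =>
      inner_tsum_dysonTerm hH hγ hG t p.1 p.2.1 p.2.2 q.1 q.2.1 q.2.2
  choose R hRn hR using h1
  have hR' : ∀ t ψ n x, R t (productKet S F ψ n x) = ∑' N, dysonTerm H L γ N t ψ n x :=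
    fun t ψ n x => hR t (ψ, ⟨n, x⟩)
  have hd : ∀ t ψ n x, HasDerivAt (fun s => R s (productKet S F ψ n x))
        (R t (interaction H L (γ t) (productKet S F) ψ n x)) t := by
    intro t ψ n x
    have h2 := interaction_map (R t).toLinearMap H L (γ t) (productKet S F) ψ n x
    simp only [ContinuousLinearMap.coe_coe] at h2
    rw [← h2]
    simp only [hR']
    exact hasDerivAt_tsum_dysonTerm hγ hG t ψ n x
  refine ⟨R, ext_ket_productVec fun ψ n x => ?_, hRn, ?_, hd⟩
  · change R 0 (productKet S F ψ n x) = productKet S F ψ n x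
    rw [hR', tsum_eq_single 0]
    · rfl
    · intro N hN
      obtain ⟨N, rfl⟩ := Nat.exists_eq_succ_of_ne_zero hN
      exact dysonTerm_succ_zero N ψ n x
  · exact continuous_apply_of_span_range span_ketFamily hRn fun p =>
      continuous_iff_continuousAt.2 fun t => (hd t p.1 p.2.1 p.2.2).continuousAt

/-- The total Hamiltonian generates a unitary group. -/
theorem exists_isGroupOf_totalHamiltonian [CompleteSpace F] (hH : IsSelfAdjoint H) (L : S →L[ℂ] S)
    {h : F →ₗ.[ℂ] F} (hh : IsSelfAdjoint h) (g : F) :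
    ∃ V, IsGroupOf (totalHamiltonian H L h g) V := by
  obtain ⟨u, hu⟩ := exists_isGroupOf_graph hh
  have hUu := hu.isUnitaryGroup
  obtain ⟨W, hW, hWu⟩ := exists_secondQuantGroup (S := S) hUu
  let γ : ℝ → F := fun s => u (-s) g
  have hγ : Continuous γ := (hUu.continuous g).comp continuous_neg
  have hG : ∀ t, ‖γ t‖ ≤ ‖g‖ := fun t => (hUu.norm_map _ _).le
  obtain ⟨R, hR0, hRn, hRc, hRd⟩ := exists_interactionPicture (L := L) hH hγ hG
  -- R_t stands for e^{itH_Tot} e^{-itH_0}, for which this identity is the group law. As functions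
  -- of the second time, both sides solve the interaction equation with coupling γ_{s+r} and agree
  -- at r = 0, so uniqueness applies.
  have hcocycle : ∀ s t ξ, R s (W (-s) (R t (W s ξ))) = R (s + t) ξ := by
    intro s t
    suffices (R s).comp ((W (-s)).comp ((R t).comp (W s))) = R (s + t) from
      fun ξ => DFunLike.congr_fun this ξ
    refine ext_ket_productVec fun ψ n x => ?_
    rw [← sub_eq_zero]
    let Z : ℝ → S → (n : ℕ) → (Fin n → F) → Total S F := fun r ψ n x =>
      R s (W (-s) (R r (productKet S F ψ n fun i => u s (x i)))) - R (s + r) (productKet S F ψ n x)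
    have hb : ∀ r, ProductBound 2 0 (Z r) := by
      intro r ψ n x
      have h1 := productBound_productKet (S := S) (F := F) ψ n x
      have h2 := productBound_productKet (S := S) (F := F) ψ n fun i => u s (x i)
      simp only [hUu.norm_map] at h2
      refine (norm_sub_le _ _).trans ?_
      simp only [hRn, hW.norm_map]
      linarith
    have h0 : ∀ ψ n x, Z 0 ψ n x = 0 := by
      intro ψ n x
      simp only [Z, hR0, one_apply_eq_self, add_zero, productKet]
      rw [← hWu, hW.neg_apply_apply, sub_self]
    have hd : ∀ r ψ n x, HasDerivAt (fun r => Z r ψ n x)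
        (interaction H L (γ (s + r)) (Z r) ψ n x) r := by
      intro r ψ n x
      have h1 := (((R s).comp (W (-s))).restrictScalars ℝ).hasFDerivAt.comp_hasDerivAt r
        (hRd r ψ n fun i => u s (x i))
      have h2 := (hRd (s + r) ψ n x).comp_const_add s r
      refine (h1.sub h2).congr_deriv ?_
      have h4 : u s (γ (s + r)) = γ r := by
        simp only [γ]
        rw [← hUu.map_add_apply]
        congr 2
        ring
      have h3 := interaction_comp_isometry H L (γ (s + r)) (hUu.norm_map s)
        (fun ψ n x => R s (W (-s) (R r (productKet S F ψ n x)))) ψ n x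
      have h5 := interaction_map (((R s).comp (W (-s))).comp (R r)).toLinearMap H L (γ r)
        (productKet S F) ψ n fun i => u s (x i)
      have h6 := interaction_map (R (s + r)).toLinearMap H L (γ (s + r)) (productKet S F) ψ n x
      rw [h4] at h3
      have h7 := interaction_sub H L (γ (s + r))
        (fun ψ n x => R s (W (-s) (R r (productKet S F ψ n fun i => u s (x i)))))
        (fun ψ n x => R (s + r) (productKet S F ψ n x)) ψ n x
      exact ((h7.trans (congrArg₂ (· - ·) (h3.trans h5) h6))).symm
    have key := eq_zero_of_hasDerivAt_interaction H L (γ := fun r => γ (s + r)) (G := ‖g‖)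
      (Z := Z) (fun t => hG _) (fun T => ⟨2, by norm_num, fun r _ => hb r⟩) h0 hd t ψ n x
    simpa only [Z, ContinuousLinearMap.comp_apply, productKet, hWu] using key
  -- This product is the candidate for e^{-itH_Tot}; its group law is the cocycle identity at the
  -- times −s and −t.
  have hVU : IsUnitaryGroup fun t => (R (-t)).comp (W t) := by
    refine ⟨?_, fun s t => ?_, fun t ξ => ?_, fun ξ => ?_⟩
    · rw [neg_zero, hR0, hW.map_zero]
      rfl
    · ext ξ
      simp only [ContinuousLinearMap.comp_apply]
      have h1 := hcocycle (-s) (-t) (W (s + t) ξ)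
      rw [neg_neg, ← hW.map_add_apply (-s), neg_add_cancel_left] at h1
      rw [h1, neg_add]
    · simp only [ContinuousLinearMap.comp_apply, hRn, hW.norm_map]
    · exact (continuous_apply_of_norm_map (A := fun t => R (-t)) (fun t => hRn _)
        fun x => (hRc x).comp continuous_neg).comp (continuous_id.prodMk (hW.continuous ξ))
  refine ⟨_, hVU.isGroupOf_span ?_⟩
  rintro _ ⟨ψ, n, x, rfl⟩
  have h1 := hasDerivAt_ket_productVec hu ψ x
  simp only [← hWu] at h1
  have h2 := (hRd (-0) ψ n fun i => (x i : F)).scomp (0 : ℝ) (hasDerivAt_neg (0 : ℝ))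
  have h3 := hasDerivAt_apply_of_norm_map (A := fun t => R (-t)) (fun t => hRn _) h1
    (by simpa [hW.map_zero, Function.comp_def, productKet] using h2)
    ((hRc _).comp continuous_neg).continuousAt
  refine h3.congr_deriv ?_
  have h4 : γ 0 = g := by simp [γ, hUu.map_zero]
  simp only [neg_zero, hR0, one_apply_eq_self, h4]
  rw [interaction_productKet]
  module

end Dyson

/-! ### Integrals over the time set of functions cut off to a compact interval. -/

section TimeMeasure

variable {E : Type*} [NormedAddCommGroup E]

theorem integrable_timeMeasure_comp_val {T : Set ℝ} (hT : T.OrdConnected) {a b : ℝ}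
    {d : ℝ → E} (hd : Continuous d) :
    Integrable (fun τ : T => (Set.Icc a b).indicator d τ) (timeMeasure T) := by
  have h1 : Integrable ((Set.Icc a b).indicator d) :=
    (hd.integrableOn_Icc).integrable_indicator measurableSet_Icc
  exact ((MeasurableEmbedding.subtype_coe hT.measurableSet).integrableOn_range_iff_comap).1
    h1.integrableOn

theorem integral_timeMeasure_indicator_Icc [NormedSpace ℝ E] {T : Set ℝ} (hT : T.OrdConnected)
    {a b : ℝ} (hab : a ≤ b) (ha : a ∈ T) (hb : b ∈ T) (d : ℝ → E) :
    ∫ τ : T, (Set.Icc a b).indicator d τ ∂(timeMeasure T) = ∫ s in a..b, d s := by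
  rw [timeMeasure, integral_subtype_comap hT.measurableSet, setIntegral_indicator measurableSet_Icc,
    Set.inter_eq_self_of_subset_right (hT.out ha hb), integral_Icc_eq_integral_Ioc,
    intervalIntegral.integral_of_le hab]

end TimeMeasure

/-! ### The evolved vacuum depends on f only through its trajectory over [0,t]. -/

section Hybrid

variable {S F : Type*} [NormedAddCommGroup S] [InnerProductSpace ℂ S] [CompleteSpace S]
  [NormedAddCommGroup F] [InnerProductSpace ℂ F] [CompleteSpace F]

/-- The directional derivatives of the hybrid representation of the evolved vacuum depend on the
direction only through its trajectory over `[0, t]`. -/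
theorem exists_hasDerivAt_hybrid_evolution {H : S →L[ℂ] S} (hH : IsSelfAdjoint H) (L : S →L[ℂ] S)
    {h : F →ₗ.[ℂ] F} (hh : IsSelfAdjoint h) (g : F) (φ : S) (t : ℝ) (f : F) :
    ∃ d : ℝ → S, Continuous d ∧ ∀ k : F,
      HasDerivAt (fun ε : ℂ => hybrid (evolution H L h g t (ket φ vac)) (f + starRingEnd ℂ ε • k))
        (∫ s in (0 : ℝ)..t, inner ℂ k (unitaryGroup h.graph (-s) g) • d s) 0 := by
  have hV := isGroupOf_unitaryGroup (exists_isGroupOf_totalHamiltonian hH L hh g)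
  have hu := (isGroupOf_unitaryGroup (exists_isGroupOf_graph hh)).isUnitaryGroup
  have hW := (unitaryGroup_freeHamiltonian (S := S) hh).1.isUnitaryGroup
  have hVc := continuous_apply_of_norm_map hV.isUnitaryGroup.norm_map hV.isUnitaryGroup.continuous
  have hWc := continuous_apply_of_norm_map hW.norm_map hW.continuous
  let V := unitaryGroup (totalHamiltonian H L h g)
  let W := unitaryGroup (freeHamiltonian S h)
  let q : ℝ → Total S F := fun s => V (-s) (W s (systemOp L (W (-s) (V s (ket φ vac)))))
  have hq : Continuous q := by
    refine hVc.comp (continuous_neg.prodMk (hWc.comp (continuous_id.prodMk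
      ((systemOp L).continuous.comp (hWc.comp (continuous_neg.prodMk
        (hV.isUnitaryGroup.continuous _)))))))
  -- A sends Ξ to the hybrid representation of U_t Ξ at f, so A(q_s) is the density of the
  -- derivative and does not involve k.
  let A : Total S F →L[ℂ] S :=
    (ContinuousLinearMap.adjoint (ketCLM (S := S) (expVec f))).comp ((W (-t)).comp (V t))
  refine ⟨fun s => A (q s), A.continuous.comp hq, fun k => ?_⟩
  have h1 := hasDerivAt_hybrid (fun ψ n x =>
    inner_creation_evolution hh hV φ k q hq (fun s => rfl) t ψ n x) f
  refine h1.congr_deriv ?_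
  have h2 : Continuous fun s => inner ℂ k (unitaryGroup h.graph (-s) g) • q s :=
    (Continuous.inner (𝕜 := ℂ) continuous_const ((hu.continuous g).comp continuous_neg)).smul hq
  refine (A.intervalIntegral_comp_comm (h2.intervalIntegrable 0 t)).symm.trans ?_
  simp only [map_smul]

theorem hybrid_evolution_add_eq {H : S →L[ℂ] S} (hH : IsSelfAdjoint H) (L : S →L[ℂ] S)
    {h : F →ₗ.[ℂ] F} (hh : IsSelfAdjoint h) (g : F) (φ : S) {t : ℝ} (ht : 0 ≤ t) (f : F) {k : F}
    (hk : ∀ s ∈ Set.Icc 0 t, inner ℂ k (unitaryGroup h.graph (-s) g) = 0) :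
    hybrid (evolution H L h g t (ket φ vac)) (f + k) =
      hybrid (evolution H L h g t (ket φ vac)) f := by
  set Φ := hybrid (evolution H L h g t (ket φ vac))
  -- Every point of the line serves as a new base point. The density d changes with it, but the
  -- integrand vanishes in all cases.
  have h1 : ∀ ε₀ : ℂ, HasDerivAt (fun ε : ℂ => Φ (f + starRingEnd ℂ ε • k)) 0 ε₀ := by
    intro ε₀
    obtain ⟨d, -, hd⟩ := exists_hasDerivAt_hybrid_evolution hH L hh g φ t
      (f + starRingEnd ℂ ε₀ • k)
    have h2 := hd k
    rw [intervalIntegral.integral_congr (g := fun _ => (0 : S)) fun s hs => by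
      rw [Set.uIcc_of_le ht] at hs
      simp only [hk s hs, zero_smul], intervalIntegral.integral_zero, ← sub_self ε₀] at h2
    refine (h2.comp_sub_const ε₀ ε₀).congr_of_eventuallyEq (Eventually.of_forall fun ε => ?_)
    simp only [Φ]
    congr 1
    rw [map_sub, sub_smul]
    abel
  have h2 := is_const_of_deriv_eq_zero (fun s => (h1 s).differentiableAt) (fun s => (h1 s).deriv)
    1 0
  simpa using h2

theorem hybrid_evolution_congr {H : S →L[ℂ] S} (hH : IsSelfAdjoint H) (L : S →L[ℂ] S)
    {h : F →ₗ.[ℂ] F} (hh : IsSelfAdjoint h) (g : F) (φ : S) {t : ℝ} (ht : 0 ≤ t) {f f' : F}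
    (hf : ∀ s ∈ Set.Icc 0 t, inner ℂ f (unitaryGroup h.graph (-s) g) =
      inner ℂ f' (unitaryGroup h.graph (-s) g)) :
    hybrid (evolution H L h g t (ket φ vac)) f = hybrid (evolution H L h g t (ket φ vac)) f' := by
  have h1 := hybrid_evolution_add_eq hH L hh g φ ht f' (k := f - f') fun s hs => by
    rw [inner_sub_left, hf s hs, sub_self]
  rwa [add_sub_cancel] at h1

end Hybrid

end BathModel

end

/-! ### The three claims. -/

theorem mainTheorem7 {S F : Type*}
    [NormedAddCommGroup S] [InnerProductSpace ℂ S] [CompleteSpace S]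
    [NormedAddCommGroup F] [InnerProductSpace ℂ F] [CompleteSpace F]
    (H L : S →L[ℂ] S) (hH : IsSelfAdjoint H)
    (h : F →ₗ.[ℂ] F) (hh : IsSelfAdjoint h) (g : F) (φ : S)
    (T : Set ℝ) (hT : T.OrdConnected) (t : ℝ) (ht : 0 ≤ t) (h0T : 0 ∈ T) (htT : t ∈ T)
    (Ψ : BathModel.Trajectories h g T → S)
    (hΨ : Ψ = BathModel.hybridTraj h g T
      (BathModel.evolution H L h g t (BathModel.ket φ BathModel.vac))) :
    (∀ f : F, Ψ (BathModel.trajectoryOf h g T f) =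
      BathModel.hybrid (BathModel.evolution H L h g t (BathModel.ket φ BathModel.vac)) f) ∧
    (∀ z z' : BathModel.Trajectories h g T,
      (∀ s : T, (s : ℝ) ∈ Set.Icc 0 t → (z : T → ℂ) s = (z' : T → ℂ) s) → Ψ z = Ψ z') ∧
    (∀ z : BathModel.Trajectories h g T, ∃ D : T → S,
      BathModel.HasFunctionalDeriv Ψ D z ∧
      ∀ τ : T, (τ : ℝ) ∉ Set.Icc 0 t → D τ = 0) := by
  have hsub : Set.Icc 0 t ⊆ T := hT.out h0T htT
  have h1 : ∀ f : F, Ψ (BathModel.trajectoryOf h g T f) =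
      BathModel.hybrid (BathModel.evolution H L h g t (BathModel.ket φ BathModel.vac)) f := by
    intro f
    rw [hΨ, BathModel.hybridTraj]
    -- The chosen preimage has the trajectory of f on all of T, and T contains [0,t].
    refine BathModel.hybrid_evolution_congr hH L hh g φ ht fun s hs => ?_
    exact congrFun (LinearMap.mem_range.1 (BathModel.trajectoryOf h g T f).2).choose_spec
      ⟨s, hsub hs⟩
  refine ⟨h1, ?_, ?_⟩
  · rintro ⟨_, f, rfl⟩ ⟨_, f', rfl⟩ hz
    refine (h1 f).trans ((BathModel.hybrid_evolution_congr hH L hh g φ ht fun s hs => ?_).trans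
      (h1 f').symm)
    exact hz ⟨s, hsub hs⟩ hs
  · rintro ⟨_, f, rfl⟩
    obtain ⟨d, hd, hd'⟩ := BathModel.exists_hasDerivAt_hybrid_evolution hH L hh g φ t f
    have hu := (BathModel.isGroupOf_unitaryGroup
      (BathModel.exists_isGroupOf_graph hh)).isUnitaryGroup
    have hc : ∀ k : F, Continuous fun s : ℝ =>
        inner ℂ k (BathModel.unitaryGroup h.graph (-s) g) • d s := fun k =>
      (Continuous.inner (𝕜 := ℂ) continuous_const ((hu.continuous g).comp continuous_neg)).smul hd
    have hi : ∀ k : F, (fun τ : T => BathModel.trajectory h g T k τ •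
        (Set.Icc 0 t).indicator d τ) = fun τ : T => (Set.Icc 0 t).indicator
          (fun s : ℝ => inner ℂ k (BathModel.unitaryGroup h.graph (-s) g) • d s) τ := fun k =>
      funext fun τ => by
        by_cases hτ : (τ : ℝ) ∈ Set.Icc 0 t
        · simp only [Set.indicator_of_mem hτ]
          rfl
        · simp only [Set.indicator_of_notMem hτ, smul_zero]
    -- The density d is defined and continuous on all of ℝ; cutting it off does not affect the
    -- integral over [0,t] and makes integrability automatic.
    refine ⟨fun τ => (Set.Icc 0 t).indicator d τ, ⟨?_, ?_, ?_⟩, fun τ hτ =>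
      Set.indicator_of_notMem hτ d⟩
    · exact (BathModel.integrable_timeMeasure_comp_val hT hd).locallyIntegrable
    · rintro ⟨_, k, rfl⟩
      simp only [hi k]
      exact BathModel.integrable_timeMeasure_comp_val hT (hc k)
    · rintro ⟨_, k, rfl⟩
      simp only [hi k]
      rw [BathModel.integral_timeMeasure_indicator_Icc hT ht h0T htT]
      refine (hd' k).congr_of_eventuallyEq (Filter.Eventually.of_forall fun ε => ?_)
      -- Trajectories are conjugate-linear in f, so ζ(f) + εζ(k) is the trajectory of f + conj(ε)k.
      refine Eq.trans (congrArg Ψ (Subtype.ext ?_)) (h1 (f + starRingEnd ℂ ε • k))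
      change BathModel.trajectory h g T f + ε • BathModel.trajectory h g T k =
        BathModel.trajectory h g T (f + starRingEnd ℂ ε • k)
      rw [map_add, LinearMap.map_smulₛₗ, Complex.conj_conj]
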